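/- **Setting.** Let $\Sigma$ be a finite alphabet, $\#\notin\Sigma$ a padding symbol, $X=\{x_1,\dots,x_k\}$ a set of word variables with $k\ge 1$, and $\hat\Sigma=(\Sigma\cup\{\#\})^X$. A *context-free hypergrammar* (CFHG) $G=\langle\Sigma,X,V,V_0,P,\alpha\rangle$ consists of a context-free grammar $\hat G=\langle\hat\Sigma,V,V_0,P\rangle$ and a quantification condition $\alpha=\mathbb Q_1x_1\cdots\mathbb Q_kx_k$ with $\mathbb Q_i\in\{\exists,\forall\}$. For an assignment $u:X\to(\Sigma\cup\{\#\})^*$ let $\mathbf w_u\in\hat\Sigma^*$ be the word whose $i$-th letter consists of the $i$-th letters of the words $u(x)$, where shorter words are padded with $\#$ at the end. For a language $\mathcal L\subseteq\Sigma^*$ define: $\mathcal L\vdash_u(\epsilon,\hat G)$ iff $\mathbf w_u\in\mathcal L(\hat G)$; and $\mathcal L\vdash_u(\exists x.\alpha',\hat G)$ (respectively $\mathcal L\vdash_u(\forall x.\alpha',\hat G)$) iff for some (respectively every) $w\in\mathcal L$ there is a word $w_\#$ that becomes $w$ when all its $\#$ are deleted such that $\mathcal L\vdash_{u[x\mapsto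 w_\#]}(\alpha',\hat G)$. The *hyperlanguage* $\mathfrak L(G)$ is the set of all nonempty languages $\mathcal L$ with $\mathcal L\vdash(\alpha,\hat G)$, and $G$ is *nonempty* if $\mathfrak L(G)\neq\emptyset$. For $\hat\sigma\in\hat\Sigma$ let $t(\hat\sigma)=\{x\in X: \hat\sigma(x)=\#\}$. The *rule graph* has as vertices the grammar variables and the right-hand sides of rules. Its edge set $E_L$ (respectively $E_R$) contains $\langle v,\gamma\rangle$ for each rule $v\to\gamma$, and $\langle\gamma,v\rangle$ whenever $\gamma$ begins (respectively ends) with the variable $v$. For a variable $v$, the left rank $\mathbf L(v)$ is the intersection of $t(\hat\sigma)$ over all letters $\hat\sigma$ that are the first symbol of a sequence reachable from $v$ along $E_L$, and the right rank $\mathbf R(v)$ is the union of $t(\hat\sigma)$ over all letters $\hat\sigma$ that are the last symbol of a sequence reachable from $v$ along $E_R$; for a letter, $\mathbf L(\hat\sigma)=\mathbf R(\hat\sigma)=t(\hat\sigma)$. A *syncCFHG* is a CFHG without rules $v\to\varepsilon$ for $v\ne V_0$ that is *ranked*: $\mathbf R(\gamma_i)\subseteq\mathbf L(\gamma_{i+1})$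 for every rule $v\to\gamma_1\cdots\gamma_m$ (with $\gamma_i\in\hat\Sigma\cup V$) and all $1\le i<m$. It is a $\forall^*$-syncCFHG if $\alpha=\forall x_1\cdots\forall x_k$, and an $\exists\forall^*$-syncCFHG if $\alpha=\exists x_1\forall x_2\cdots\forall x_k$. **Theorem.** The nonemptiness problem for $\forall^*$-syncCFHG and the nonemptiness problem for $\exists\forall^*$-syncCFHG are decidable in polynomial time: for each of the two classes there are a deterministic Turing machine and a polynomial $p$ such that, on the description of any grammar $G$ of the class, the machine halts within $p(\ell)$ steps, where $\ell$ is the length of the description, and correctly answers whether $\mathfrak L(G)\neq\emptyset$. (A description lists the sizes of $\Sigma$, $X$, $V$, the initial variable, the quantifiers and all rules, with names in binary and every letter of $\hat\Sigma$ written as its $k$ entries.) Moreover, for every $\forall^*$-syncCFHG or $\exists\forall^*$-syncCFHG $G$: 1. $\mathfrak L(G)\ne\emptyset$ if and only if $\{w\}\in\mathfrak L(G)$ for some word $w\in\Sigma^*$; 2. $\mathfrak L(G)\ne\emptyset$ if and only if $\mathcal L(\hat G')\neq\emptyset$, where $\hat G'$ is obtained from $\hat G$ by removing every rule that contains a letter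 that is not homogeneous, a letter of $\hat\Sigma$ being *homogeneous* if it assigns the same element of $\Sigma\cup\{\#\}$ to all variables of $X$. -/

import Mathlib

open Turing Computability

/-- A quantifier of a quantification condition. -/
inductive Quantifier where
  | all
  | ex

/-- A context-free hypergrammar `⟨Σ, X, V, V₀, P, α⟩`, with `Σ = Fin s`, `X = {x_0, …, x_{k-1}}`
(that is, `Fin k`), `V = Fin n`, and the quantification condition
`α = quant 0 x_0 … quant (k-1) x_{k-1}`.
A letter of the alphabet `(Σ ∪ {#})^X` is a function `Fin k → Option (Fin s)`, where `none`
stands for the padding symbol `#`. -/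
structure CFHG where
  /-- the size of the alphabet `Σ` -/
  s : ℕ
  /-- the number of word variables -/
  k : ℕ
  /-- the number of grammar variables -/
  n : ℕ
  /-- the initial grammar variable -/
  start : Fin n
  /-- the list of grammar rules -/
  rules : List (ContextFreeRule (Fin k → Option (Fin s)) (Fin n))
  /-- the quantifier of each word variable -/
  quant : Fin k → Quantifier

/-! ### The rule graph and ranks of a context-free grammar over `(A ∪ {#})^X` -/

section Ranks

variable {X A : Type} (g : ContextFreeGrammar (X → Option A))

/-- The edges `E_L` of the rule graph, whose vertices are grammar variables (a variable `v` is
identified with the one-letter sequence `v`) and right-hand sides of rules: an edge leads from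
`v` to `w` for every rule `v → w`, and from `v γ` to `v`. -/
def LeftEdge (u u' : List (Symbol (X → Option A) g.NT)) : Prop :=
  (∃ r ∈ g.rules, u = [Symbol.nonterminal r.input] ∧ u' = r.output) ∨
    ∃ v γ, u = Symbol.nonterminal v :: γ ∧ u' = [Symbol.nonterminal v]

/-- The edges `E_R` of the rule graph: an edge leads from `v` to `w` for every rule `v → w`,
and from `γ v` to `v`. -/
def RightEdge (u u' : List (Symbol (X → Option A) g.NT)) : Prop :=
  (∃ r ∈ g.rules, u = [Symbol.nonterminal r.input] ∧ u' = r.output) ∨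
    ∃ γ v, u = γ ++ [Symbol.nonterminal v] ∧ u' = [Symbol.nonterminal v]

/-- The left rank: the intersection of the ranks `t(σ) = {x | σ x = #}` over all letters `σ` that
begin a sequence reachable along `E_L`. This is the value obtained by propagating the ranks
through the strongly connected components of the graph with edges `E_L`. -/
def leftRank (u : List (Symbol (X → Option A) g.NT)) : Set X :=
  {x | ∀ σ γ, Relation.ReflTransGen (LeftEdge g) u (Symbol.terminal σ :: γ) → σ x = none}

/-- The right rank: the union of the ranks `t(σ) = {x | σ x = #}` over all letters `σ` that
end a sequence reachable along `E_R`. -/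
def rightRank (u : List (Symbol (X → Option A) g.NT)) : Set X :=
  {x | ∃ σ γ, Relation.ReflTransGen (RightEdge g) u (γ ++ [Symbol.terminal σ]) ∧ σ x = none}

/-- A grammar is ranked if `R(γ_i) ⊆ L(γ_{i+1})` for every rule `v → γ_1 ⋯ γ_m`
and all `1 ≤ i < m`. -/
def IsRanked : Prop :=
  ∀ r ∈ g.rules, ∀ α β a b, r.output = α ++ a :: b :: β →
    rightRank g [a] ⊆ leftRank g [b]

/-- There are no rules `v → ε`, except possibly for the initial variable. -/
def EpsilonFree : Prop :=
  ∀ r ∈ g.rules, r.output = [] → r.input = g.initial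

end Ranks

/-! ### Semantics of hypergrammars -/

/-- The word over `(A ∪ {#})^X` that represents an assignment of words over `A ∪ {#}` to the
variables: its `i`-th letter lists the `i`-th letters of all the words, and shorter words are
padded with `#` at their end. -/
def wordAssignment {k : ℕ} {A : Type} (u : Fin k → List (Option A)) :
    List (Fin k → Option A) :=
  (List.range (Finset.univ.sup fun j => (u j).length)).map fun i j => (u j).getD i none

namespace CFHG

/-- The underlying context-free grammar. -/
def underlying (G : CFHG) : ContextFreeGrammar (Fin G.k → Option (Fin G.s)) where
  NT := Fin G.n
  initial := G.start
  rules := G.rules.toFinset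

/-- The acceptance relation `L ⊢_u (α, Ĝ)`. The condition `w'.reduceOption = w` says that
deleting every `#` from `w'` gives `w`, that is, `w'` is in `w↑#`. -/
def Accepts (G : CFHG) (L : Language (Fin G.s)) :
    List (Quantifier × Fin G.k) → (Fin G.k → List (Option (Fin G.s))) → Prop
  | [], u => wordAssignment u ∈ G.underlying.language
  | (Quantifier.ex, x) :: α, u =>
      ∃ w ∈ L, ∃ w', w'.reduceOption = w ∧ Accepts G L α (Function.update u x w')
  | (Quantifier.all, x) :: α, u =>
      ∀ w ∈ L, ∃ w', w'.reduceOption = w ∧ Accepts G L α (Function.update u x w')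

/-- The quantification condition, as a sequence of quantified variables. -/
def condition (G : CFHG) : List (Quantifier × Fin G.k) :=
  (List.finRange G.k).map fun j => (G.quant j, j)

/-- The hyperlanguage of `G`: the set of all nonempty languages that `G` derives. As the
condition quantifies every variable, the initial assignment is irrelevant. -/
def hyperlanguage (G : CFHG) : Set (Language (Fin G.s)) :=
  {L | (∃ w, w ∈ L) ∧ G.Accepts L G.condition fun _ => []}

/-- A synchronous context-free hypergrammar. -/
def IsSync (G : CFHG) : Prop :=
  EpsilonFree G.underlying ∧ IsRanked G.underlying

/-- The quantification condition is `∀ x_0 ⋯ ∀ x_{k-1}` with `k ≥ 1`. -/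
def IsForall (G : CFHG) : Prop :=
  0 < G.k ∧ ∀ j, G.quant j = Quantifier.all

/-- The quantification condition is `∃ x_0 ∀ x_1 ⋯ ∀ x_{k-1}` with `k ≥ 1`. -/
def IsExistsForall (G : CFHG) : Prop :=
  0 < G.k ∧ ∀ j : Fin G.k,
    G.quant j = if (j : ℕ) = 0 then Quantifier.ex else Quantifier.all

open Classical in
/-- The underlying grammar restricted to the homogeneous letters, i.e. those that carry the same
element of `Σ ∪ {#}` at every variable: all rules that contain another letter are removed. -/
noncomputable def homogeneous (G : CFHG) :
    ContextFreeGrammar (Fin G.k → Option (Fin G.s)) where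
  NT := Fin G.n
  initial := G.start
  rules := G.rules.toFinset.filter fun r =>
    ∀ σ, Symbol.terminal σ ∈ r.output → ∃ a, σ = fun _ => a

/-! ### Hypergrammars as inputs of Turing machines

Names of letters and variables are written in binary and terminated by a comma; the symbol `#` is
written as a blank; letters of `(Σ ∪ {#})^X` and rules are put in brackets. The description of a
hypergrammar can be parsed uniquely from left to right. -/

/-- The description of a number. -/
def encodeName (m : ℕ) : List Γ' :=
  (encodeNat m).map Γ'.bit ++ [Γ'.comma]

/-- The description of an element of `Σ ∪ {#}`. -/
def encodeEntry {s : ℕ} : Option (Fin s) → List Γ'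
  | none => [Γ'.blank, Γ'.comma]
  | some a => encodeName a

/-- The description of a symbol in a rule. -/
def encodeSymbol {s k n : ℕ} : Symbol (Fin k → Option (Fin s)) (Fin n) → List Γ'
  | Symbol.terminal σ =>
      [Γ'.bra] ++ (List.finRange k).flatMap (fun j => encodeEntry (σ j)) ++ [Γ'.ket]
  | Symbol.nonterminal v => encodeName v

/-- The description of a rule. -/
def encodeRule {s k n : ℕ} (r : ContextFreeRule (Fin k → Option (Fin s)) (Fin n)) : List Γ' :=
  [Γ'.bra] ++ encodeName r.input ++ r.output.flatMap encodeSymbol ++ [Γ'.ket]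

/-- The description of a quantifier. -/
def encodeQuantifier : Quantifier → Γ'
  | Quantifier.all => Γ'.bit false
  | Quantifier.ex => Γ'.bit true

/-- The description of a hypergrammar. -/
def encode (G : CFHG) : List Γ' :=
  encodeName G.s ++ encodeName G.k ++ encodeName G.n ++ encodeName G.start ++
    (List.finRange G.k).map (fun j => encodeQuantifier (G.quant j)) ++
    G.rules.flatMap encodeRule

end CFHG

open Classical in
/-- The decision problem `p`, on instances in `α` described by strings over `Γ`, is decided by a
deterministic (multi-stack) Turing machine in time polynomial in the length of the description. -/
def DecidableInPolyTime {α Γ : Type} (enc : α → List Γ) (p : α → Prop) : Prop :=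
  Nonempty (TM2ComputableInPolyTime enc encodeBool fun a => decide (p a))

/-! Suppose that a language is accepted. A universal quantifier may be instantiated with any of its
words, and a leading existential quantifier supplies such a word. Hence there is a word of the
underlying grammar whose tracks all spell one and the same word `w` up to inserted `#`
(`CFHG.exists_assignment`). If no rule has an empty right-hand side, rankedness is preserved along
derivations, so a track that has reached `#` stays at `#` (`isChain_of_mem_language`). All tracks
are then `w` followed by padding up to a common length, so they coincide and every letter is
homogeneous (`homogeneous_of_isChain`). Derivations never erase letters, so only homogeneous rules
were used. If some right-hand side is empty, it belongs to the initial variable, and the empty word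
already lies in the homogeneous language.

Conversely, a homogeneous word is a single track `l` repeated for all variables. Over the singleton
language of `l` with its `#` deleted, each quantifier has only one choice, and padding that choice
to `l` every time gives acceptance (`CFHG.exists_singleton_mem_hyperlanguage`). Both equivalences
follow.

For the complexity, nonemptiness of the homogeneous grammar means that its initial variable is
productive, which is a Horn problem. A rule becomes a clause whose premises are the variables on its
right-hand side, and an inhomogeneous letter adds a premise that cannot be derived unless the
initial variable already can. Unit propagation consumes one fact per round, lowers the number of
clauses and facts, and never lengthens their description, so it takes quadratic time. It is written
as a structured stack program; `Does` composes time bounds along the program, and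
`decidableInPolyTime_of_does` turns the program into a machine. -/

/-! ### Structured programs over stacks, and their compilation to multi-stack Turing machines -/

namespace StackProgram

variable {A K R : Type}

/-- Elementary actions on finitely many stacks with entries in `A` and a register with values
in `R`. -/
inductive Act (A K R : Type) where
  /-- push a fixed entry -/
  | push (k : K) (a : A)
  /-- remove the top entry -/
  | drop (k : K)
  /-- move the top entry from one stack to another -/
  | move (k l : K)
  /-- update the register according to the top entries of two stacks -/
  | look (k l : K) (f : R → Option A → Option A → R)

/-- Structured programs. -/
inductive Prog (A K R : Type) where
  /-- perform a list of actions -/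
  | acts (l : List (Act A K R))
  /-- sequential composition -/
  | seq (p q : Prog A K R)
  /-- branching on the register and the top entry of a stack -/
  | ite (k : K) (b : R → Option A → Bool) (p q : Prog A K R)
  /-- a loop that runs as long as the top entry of a stack satisfies a condition -/
  | loop (k : K) (b : Option A → Bool) (p : Prog A K R)

/-- Sequential composition of programs. -/
notation:60 p:61 " ⨾ " q:60 => Prog.seq p q

/-- The memory of a program: the register and the stacks. -/
abbrev Mem (A K R : Type) := R × (K → List A)

section Semantics

variable [DecidableEq K]

/-- The effect of an action. -/
def Act.exec : Act A K R → Mem A K R → Mem A K R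
  | .push k a, (r, S) => (r, Function.update S k (a :: S k))
  | .drop k, (r, S) => (r, Function.update S k (S k).tail)
  | .move k l, (r, S) =>
    match S k with
    | [] => (r, S)
    | a :: t =>
      (r, Function.update (Function.update S k t) l (a :: Function.update S k t l))
  | .look k l f, (r, S) => (f r (S k).head? (S l).head?, S)

/-- The labels of the machine that runs a program. -/
def Prog.Label : Prog A K R → Type
  | .acts _ => Unit
  | .seq p q => p.Label ⊕ q.Label
  | .ite _ _ p q => Option (p.Label ⊕ q.Label)
  | .loop _ _ p => Option p.Label

instance Prog.fintypeLabel : ∀ p : Prog A K R, Fintype p.Label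
  | .acts _ => inferInstanceAs (Fintype Unit)
  | .seq p q =>
    letI := p.fintypeLabel
    letI := q.fintypeLabel
    inferInstanceAs (Fintype (p.Label ⊕ q.Label))
  | .ite _ _ p q =>
    letI := p.fintypeLabel
    letI := q.fintypeLabel
    inferInstanceAs (Fintype (Option (p.Label ⊕ q.Label)))
  | .loop _ _ p =>
    letI := p.fintypeLabel
    inferInstanceAs (Fintype (Option p.Label))

/-- The label at which the run of a program starts. -/
def Prog.entry : (p : Prog A K R) → p.Label
  | .acts _ => ()
  | .seq p _ => Sum.inl p.entry
  | .ite _ _ _ _ => none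
  | .loop _ _ _ => none

/-- The stack alphabets of the compiled machine, which has an additional output stack. -/
abbrev StackAlphabet (A K : Type) : Option K → Type
  | none => Bool
  | some _ => A

/-- The stacks of the compiled machine while it runs a program. -/
def machineStacks (S : K → List A) : ∀ k : Option K, List (StackAlphabet A K k)
  | none => []
  | some k => S k

/-- Statements of the compiled machine, whose internal state holds the register and a buffer. -/
abbrev MachineStmt (A K R L : Type) := TM2.Stmt (StackAlphabet A K) L (R × Option A)

/-! ### Compilation of programs to machine statements. -/

variable {L : Type}

/-- The compilation of an action. -/
def Act.stmt [Inhabited A] : Act A K R → MachineStmt A K R L → MachineStmt A K R L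
  | .push k a, q => .push (some k) (fun _ => a) q
  | .drop k, q => .pop (some k) (fun v _ => v) q
  | .move k l, q =>
    .pop (some k) (fun v a => (v.1, a)) <| .branch (fun v => v.2.isSome)
      (.push (some l) (fun v => v.2.getD default) <| .load (fun v => (v.1, none)) q)
      (.load (fun v => (v.1, none)) q)
  | .look k l f, q =>
    .peek (some k) (fun v a => (v.1, a)) <|
      .peek (some l) (fun v b => (f v.1 v.2 b, none)) q

/-- The compilation of a test: peek at a stack and go to one of two labels. -/
def testStmt (k : K) (b : R → Option A → Bool) (l₁ l₂ : L) : MachineStmt A K R L :=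
  .peek (some k) (fun v a => (v.1, a)) <| .branch (fun v => b v.1 v.2)
    (.load (fun v => (v.1, none)) <| .goto fun _ => l₁)
    (.load (fun v => (v.1, none)) <| .goto fun _ => l₂)

/-- The compilation of a program to statements with labels in `L`. -/
def Prog.stmt [Inhabited A] :
    (p : Prog A K R) → (p.Label → L) → L → p.Label → MachineStmt A K R L
  | .acts l, _, exit, _ => l.foldr Act.stmt (.goto fun _ => exit)
  | .seq p q, e, exit, l =>
    match l with
    | .inl l => p.stmt (e ∘ Sum.inl) (e (Sum.inr q.entry)) l
    | .inr l => q.stmt (e ∘ Sum.inr) exit l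
  | .ite k b p q, e, exit, l =>
    match l with
    | none => testStmt k b (e (some (.inl p.entry))) (e (some (.inr q.entry)))
    | some (.inl l) => p.stmt (e ∘ some ∘ Sum.inl) exit l
    | some (.inr l) => q.stmt (e ∘ some ∘ Sum.inr) exit l
  | .loop k b p, e, exit, l =>
    match l with
    | none => testStmt k (fun _ => b) (e (some p.entry)) exit
    | some l => p.stmt (e ∘ some) (e none) l

/-- The machine configuration with a given label and memory. -/
def config (l : L) (m : Mem A K R) : TM2.Cfg (StackAlphabet A K) L (R × Option A) :=
  ⟨some l, (m.1, none), machineStacks m.2⟩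

/-- The configuration `c'` is reached from `c` in exactly `t` steps. -/
def ReachesIn (M : L → MachineStmt A K R L) (c c' : TM2.Cfg (StackAlphabet A K) L (R × Option A))
    (t : ℕ) : Prop :=
  (flip bind (TM2.step M))^[t] (some c) = some c'

lemma ReachesIn.trans {M : L → MachineStmt A K R L}
    {c c' c'' : TM2.Cfg (StackAlphabet A K) L (R × Option A)} {t t' : ℕ}
    (h : ReachesIn M c c' t) (h' : ReachesIn M c' c'' t') : ReachesIn M c c'' (t + t') := by
  unfold ReachesIn at *
  rw [add_comm, Function.iterate_add_apply, h, h']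

lemma ReachesIn.single {M : L → MachineStmt A K R L}
    {c c' : TM2.Cfg (StackAlphabet A K) L (R × Option A)} (h : TM2.step M c = some c') :
    ReachesIn M c c' 1 := h

/-- The program `p` transforms the memory `m` into `m'` within `n` steps, in every machine that
contains its compilation. -/
def Does [Inhabited A] (p : Prog A K R) (m m' : Mem A K R) (n : ℕ) : Prop :=
  ∀ (L : Type) (M : L → MachineStmt A K R L) (e : p.Label → L) (exit : L),
    (∀ l, M (e l) = p.stmt e exit l) →
      ∃ t ≤ n, ReachesIn M (config (e p.entry) m) (config exit m') t

lemma update_machineStacks (S : K → List A) (k : K) (x : List A) :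
    Function.update (machineStacks S) (some k) x = machineStacks (Function.update S k x) := by
  funext j
  rcases j with _ | j
  · simp [machineStacks]
  · by_cases h : j = k
    · subst h; simp [machineStacks]
    · simp [machineStacks, h]

lemma step_test {M : L → MachineStmt A K R L} {l l₁ l₂ : L} {k : K}
    {b : R → Option A → Bool} (hM : M l = testStmt k b l₁ l₂) (m : Mem A K R) :
    TM2.step M (config l m) = some (config (if b m.1 (m.2 k).head? then l₁ else l₂) m) := by
  obtain ⟨r, S⟩ := m
  simp only [config, TM2.step, hM, testStmt, TM2.stepAux]
  have h : machineStacks S (some k) = S k := rfl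
  rw [h]
  cases b r (S k).head? <;> rfl

/-! ### Effects and step counts of compiled programs. -/

variable [Inhabited A]

/-- The buffer is empty before and after each compiled action, so actions can be chained and only
the register and the stacks need to be tracked. -/
lemma stepAux_act (a : Act A K R) (q : MachineStmt A K R L) (m : Mem A K R) :
    TM2.stepAux (a.stmt q) (m.1, none) (machineStacks m.2) =
      TM2.stepAux q ((a.exec m).1, none) (machineStacks (a.exec m).2) := by
  obtain ⟨r, S⟩ := m
  cases a with
  | push k a => simp only [Act.stmt, TM2.stepAux, update_machineStacks]; rfl
  | drop k => simp only [Act.stmt, TM2.stepAux, update_machineStacks]; rfl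
  | look k l f => rfl
  | move k l =>
    simp only [Act.stmt, TM2.stepAux, update_machineStacks]
    have h : machineStacks S (some k) = S k := rfl
    rw [h]
    rcases hS : S k with _ | ⟨a, t⟩
    · simp only [List.head?_nil, Option.isSome_none, cond_false, Act.exec, hS,
        List.tail_nil]
      rw [← hS, Function.update_eq_self]
    · simp only [List.head?_cons, Option.isSome_some, cond_true, Act.exec, hS,
        List.tail_cons, Option.getD_some]
      rfl

/-- A list of actions is compiled to a single statement, so it takes one machine step whatever its
length. -/
lemma Does.acts (l : List (Act A K R)) (m : Mem A K R) :
    Does (.acts l) m (l.foldl (fun m a => a.exec m) m) 1 := by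
  intro L M e exit hM
  refine ⟨1, le_rfl, ReachesIn.single ?_⟩
  simp only [config, TM2.step, hM, Prog.stmt]
  clear hM
  congr 1
  induction l generalizing m with
  | nil => rfl
  | cons a l ih => rw [List.foldr_cons, stepAux_act, List.foldl_cons]; exact ih _ (fun _ => e ())

lemma Does.mono {p : Prog A K R} {m m' : Mem A K R} {n n' : ℕ} (h : Does p m m' n)
    (hn : n ≤ n') : Does p m m' n' := fun L M e exit hM =>
  let ⟨t, ht, h⟩ := h L M e exit hM
  ⟨t, ht.trans hn, h⟩

lemma Does.seq {p q : Prog A K R} {m m' m'' : Mem A K R} {n n' : ℕ} (h : Does p m m' n)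
    (h' : Does q m' m'' n') : Does (p ⨾ q) m m'' (n + n') := by
  intro L M e exit hM
  obtain ⟨t, ht, h⟩ := h L M (e ∘ Sum.inl) (e (Sum.inr q.entry)) fun l => hM (Sum.inl l)
  obtain ⟨t', ht', h'⟩ := h' L M (e ∘ Sum.inr) exit fun l => hM (Sum.inr l)
  exact ⟨t + t', by omega, h.trans h'⟩

lemma Does.ite_true {p q : Prog A K R} {k : K} {b : R → Option A → Bool} {m m' : Mem A K R}
    {n : ℕ} (hb : b m.1 (m.2 k).head? = true) (h : Does p m m' n) :
    Does (.ite k b p q) m m' (n + 1) := by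
  intro L M e exit hM
  obtain ⟨t, ht, h⟩ := h L M (e ∘ some ∘ Sum.inl) exit fun l => hM (some (Sum.inl l))
  refine ⟨1 + t, by omega, (ReachesIn.single ?_).trans h⟩
  exact (step_test (hM none) m).trans (by rw [if_pos hb]; rfl)

lemma Does.ite_false {p q : Prog A K R} {k : K} {b : R → Option A → Bool} {m m' : Mem A K R}
    {n : ℕ} (hb : b m.1 (m.2 k).head? = false) (h : Does q m m' n) :
    Does (.ite k b p q) m m' (n + 1) := by
  intro L M e exit hM
  obtain ⟨t, ht, h⟩ := h L M (e ∘ some ∘ Sum.inr) exit fun l => hM (some (Sum.inr l))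
  refine ⟨1 + t, by omega, (ReachesIn.single ?_).trans h⟩
  exact (step_test (hM none) m).trans (by rw [if_neg (by simp [hb])]; rfl)

lemma Does.loop_done {p : Prog A K R} {k : K} {b : Option A → Bool} {m : Mem A K R}
    (hb : b (m.2 k).head? = false) : Does (.loop k b p) m m 1 := by
  intro L M e exit hM
  refine ⟨1, le_rfl, ReachesIn.single ?_⟩
  exact (step_test (b := fun _ => b) (hM none) m).trans (by rw [if_neg (by simp [hb])])

lemma Does.loop_step {p : Prog A K R} {k : K} {b : Option A → Bool} {m m' m'' : Mem A K R}
    {n n' : ℕ} (hb : b (m.2 k).head? = true) (h : Does p m m' n)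
    (h' : Does (.loop k b p) m' m'' n') : Does (.loop k b p) m m'' (n + 1 + n') := by
  intro L M e exit hM
  obtain ⟨t, ht, h⟩ := h L M (e ∘ some) (e none) fun l => hM (some l)
  obtain ⟨t', ht', h'⟩ := h' L M e exit hM
  refine ⟨1 + t + t', by omega, ((ReachesIn.single ?_).trans h).trans h'⟩
  exact (step_test (b := fun _ => b) (hM none) m).trans (by rw [if_pos hb]; rfl)

/-- The machine that runs a program and then outputs a Boolean that depends on the register. -/
def machine [Fintype A] [Fintype K] [Fintype R] (p : Prog A K R) (k₀ : K) (r₀ : R)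
    (out : R → Bool) : FinTM2 where
  K := Option K
  k₀ := some k₀
  k₁ := none
  Γ := StackAlphabet A K
  Λ := Option p.Label
  main := some p.entry
  σ := R × Option A
  initialState := (r₀, none)
  Γk₀Fin := inferInstanceAs (Fintype A)
  m
    | some l => p.stmt some none l
    | none => .push none (fun v => out v.1) <| .load (fun _ => (r₀, none)) .halt

/-- The halting configuration must have the initial internal state and empty stacks except for the
output. This is why the program has to clean up its stacks, and why the final statement resets the
register. That statement accounts for the extra step in `time + 1`. -/
theorem decidableInPolyTime_of_does [Fintype A] [Fintype K] [Fintype R] {α : Type}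
    {enc : α → List A} {P : α → Prop} (p : Prog A K R) (k₀ : K) (r₀ : R) (out : R → Bool)
    (time : Polynomial ℕ)
    (h : ∀ a, ∃ r, Does p (r₀, Function.update (fun _ => []) k₀ (enc a)) (r, fun _ => [])
      (time.eval (enc a).length) ∧ (out r = true ↔ P a)) :
    DecidableInPolyTime enc P := by
  classical
  refine ⟨{ tm := machine p k₀ r₀ out, inputAlphabet := Equiv.refl A,
            outputAlphabet := Equiv.refl Bool, time := time + 1, outputsFun := fun a => ?_ }⟩
  have key : ∃ t ≤ (time + 1).eval (enc a).length,
      (flip bind (machine p k₀ r₀ out).step)^[t] (some (initList (machine p k₀ r₀ out) (enc a))) =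
        some (haltList (machine p k₀ r₀ out) [decide (P a)]) := by
    obtain ⟨r, hr, hP⟩ := h a
    obtain ⟨t, ht, hr⟩ := hr (Option p.Label) (machine p k₀ r₀ out).m some none fun _ => rfl
    have hinit : initList (machine p k₀ r₀ out) (enc a) =
        config (some p.entry) (r₀, Function.update (fun _ => []) k₀ (enc a)) := by
      refine congrArg (TM2.Cfg.mk _ _) (funext fun j => ?_)
      rcases j with _ | j
      · exact dif_neg (Option.some_ne_none k₀).symm
      · by_cases hj : j = k₀
        · subst hj
          have h : machineStacks (Function.update (fun _ => []) j (enc a)) (some j) = enc a :=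
            Function.update_self (β := fun _ => List A) j (enc a) fun _ => []
          exact (dif_pos rfl).trans h.symm
        · have h : machineStacks (Function.update (fun _ => []) k₀ (enc a)) (some j) = [] :=
            Function.update_of_ne (β := fun _ => List A) hj (enc a) fun _ => []
          exact (dif_neg fun h => hj (Option.some.inj h)).trans h.symm
    have hhalt : TM2.step (machine p k₀ r₀ out).m (config none (r, fun _ => [])) =
        some (haltList (machine p k₀ r₀ out) [decide (P a)]) := by
      refine congrArg some (congrArg (TM2.Cfg.mk _ _) (funext fun j => ?_))
      rcases j with _ | j
      · have : out r = decide (P a) := by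
          rw [Bool.eq_iff_iff, hP, decide_eq_true_iff]
        rw [← this]
        exact (Function.update_self _ _ _).trans (Eq.symm (dif_pos rfl))
      · exact (Function.update_of_ne (Option.some_ne_none j) _ _).trans
          (Eq.symm (dif_neg (Option.some_ne_none j)))
    refine ⟨t + 1, by simpa using ht, ?_⟩
    rw [hinit]
    exact hr.trans (ReachesIn.single hhalt)
  have hin : (enc a).map (Equiv.refl A).invFun = enc a := List.map_id _
  have hout : (encodeBool (decide (P a))).map (Equiv.refl Bool).invFun = [decide (P a)] := rfl
  -- The number of steps is data in the structure to be built, so it is extracted by choice.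
  have key' := key.choose_spec
  exact { steps := key.choose
          evals_in_steps := by
            refine Eq.trans ?_ (key'.2.trans ?_)
            · exact congrArg (fun l => (flip bind (machine p k₀ r₀ out).step)^[key.choose]
                (some (initList (machine p k₀ r₀ out) l))) hin
            · exact congrArg (fun l => some (haltList (machine p k₀ r₀ out) l)) hout.symm
          steps_le_m := key'.1 }

end Semantics

end StackProgram

/-! ### A program that propagates facts through Horn clauses -/

namespace StackProgram

/-! ### Moving and removing entries of a stack. -/

section Loops

variable {A K R : Type} [DecidableEq K] [Inhabited A]

lemma Does.acts_of_eq {l : List (Act A K R)} {m m' : Mem A K R}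
    (h : l.foldl (fun m a => a.exec m) m = m') : Does (.acts l) m m' 1 :=
  h ▸ Does.acts l m

lemma Does.of_eq {p : Prog A K R} {m m' m'' : Mem A K R} {n n' : ℕ} (h : Does p m m' n)
    (hm : m' = m'') (hn : n ≤ n') : Does p m m'' n' :=
  hm ▸ h.mono hn

/-- Move entries from one stack to another while they satisfy a condition. -/
def moveWhile (b : Option A → Bool) (k l : K) : Prog A K R :=
  .loop k b (.acts [.move k l])

/-- Remove entries from a stack while they satisfy a condition. -/
def dropWhile (b : Option A → Bool) (k : K) : Prog A K R :=
  .loop k b (.acts [.drop k])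

/-- Each entry costs a test and a move, and the failing test at the end costs one more step. Moving
from stack to stack reverses the word. -/
lemma does_moveWhile {b : Option A → Bool} {k l : K} (hkl : k ≠ l) {w t : List A}
    (hw : ∀ x ∈ w, b (some x) = true) (ht : b t.head? = false) (r : R) (S : K → List A)
    (hS : S k = w ++ t) :
    Does (moveWhile b k l) (r, S)
      (r, Function.update (Function.update S k t) l (w.reverse ++ S l)) (2 * w.length + 1) := by
  induction w generalizing S with
  | nil =>
    have h : Function.update (Function.update S k t) l (([] : List A).reverse ++ S l) = S := by
      rw [List.nil_append] at hS
      rw [← hS, Function.update_eq_self]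
      exact Function.update_eq_self l S
    rw [h]
    exact Does.loop_done (by simpa [hS] using ht)
  | cons a w ih =>
    refine Does.of_eq (Does.loop_step
      (m' := (r, Function.update (Function.update S k (w ++ t)) l (a :: S l)))
      (by simpa [hS] using hw a (by simp)) (Does.acts_of_eq ?_)
      (ih (fun x hx => hw x (by simp [hx])) _ ?_)) ?_ ?_
    · simp [Act.exec, hS, hkl.symm]
    · simp [hkl]
    · congr 1
      funext j
      by_cases hj : j = l
      · subst hj; simp
      · by_cases hk : j = k
        · subst hk; simp [hkl]
        · simp [hj, hk]
    · simp; omega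

lemma does_dropWhile {b : Option A → Bool} {k : K} {w t : List A}
    (hw : ∀ x ∈ w, b (some x) = true) (ht : b t.head? = false) (r : R) (S : K → List A)
    (hS : S k = w ++ t) :
    Does (dropWhile b k) (r, S) (r, Function.update S k t) (2 * w.length + 1) := by
  induction w generalizing S with
  | nil =>
    rw [List.nil_append] at hS
    rw [← hS, Function.update_eq_self]
    exact Does.loop_done (by simpa [hS] using ht)
  | cons a w ih =>
    refine Does.of_eq (Does.loop_step (m' := (r, Function.update S k (w ++ t)))
      (by simpa [hS] using hw a (by simp)) (Does.acts_of_eq ?_)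
      (ih (fun x hx => hw x (by simp [hx])) _ ?_)) ?_ ?_
    · simp [Act.exec, hS]
    · simp
    · simp
    · simp; omega

end Loops

/-! #### Words, clauses, and their descriptions -/

/-- Words over the bits and the blank symbol. -/
abbrev Word := List (Option Bool)

/-- A clause with a head and a list of premises. -/
abbrev Clause := Word × List Word

/-- The symbol that stands for a letter of a word. -/
def charSymbol : Option Bool → Γ'
  | none => Γ'.blank
  | some b => Γ'.bit b

lemma charSymbol_injective : Function.Injective charSymbol := by
  rintro (_ | a) (_ | b) h <;> simp_all [charSymbol]

/-- The symbols of a word. -/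
def chars (w : Word) : List Γ' := w.map charSymbol

/-- The description of a word, terminated by a comma. -/
def encodeWord (w : Word) : List Γ' := chars w ++ [Γ'.comma]

/-- The description of a list of words. -/
def encodeWords (l : List Word) : List Γ' := l.flatMap encodeWord

/-- The description of a clause. -/
def encodeClause (c : Clause) : List Γ' := encodeWord c.1 ++ encodeWords c.2 ++ [Γ'.ket]

/-- The description of a list of clauses. -/
def encodeClauses (l : List Clause) : List Γ' := l.flatMap encodeClause

/-- Whether a symbol belongs to a word. -/
def isChar : Option Γ' → Bool
  | some (Γ'.bit _) => true
  | some Γ'.blank => true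
  | _ => false

@[simp] lemma isChar_none : isChar none = false := rfl
@[simp] lemma isChar_comma : isChar (some Γ'.comma) = false := rfl
@[simp] lemma isChar_ket : isChar (some Γ'.ket) = false := rfl
@[simp] lemma isChar_bra : isChar (some Γ'.bra) = false := rfl
@[simp] lemma isChar_charSymbol (a : Option Bool) : isChar (some (charSymbol a)) = true := by
  cases a <;> rfl

/-- Whether a symbol is present and does not close a bracket. -/
def notKet : Option Γ' → Bool
  | some Γ'.ket => false
  | _ => true

@[simp] lemma notKet_ket : notKet (some Γ'.ket) = false := rfl
@[simp] lemma notKet_comma : notKet (some Γ'.comma) = true := rfl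
@[simp] lemma notKet_bra : notKet (some Γ'.bra) = true := rfl
@[simp] lemma notKet_charSymbol (a : Option Bool) : notKet (some (charSymbol a)) = true := by
  cases a <;> rfl

lemma isChar_of_mem_chars {w : Word} : ∀ x ∈ chars w, isChar (some x) = true := by
  simp [chars]

lemma isChar_of_mem_reverse_chars {w : Word} :
    ∀ x ∈ (chars w).reverse, isChar (some x) = true := by
  simp [chars]

@[simp] lemma chars_nil : chars [] = [] := rfl
@[simp] lemma chars_cons (a : Option Bool) (w : Word) :
    chars (a :: w) = charSymbol a :: chars w := rfl
@[simp] lemma length_chars (w : Word) : (chars w).length = w.length := by simp [chars]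
@[simp] lemma length_encodeWord (w : Word) : (encodeWord w).length = w.length + 1 := by
  simp [encodeWord]

lemma notKet_head_encodeWord (w : Word) (t : List Γ') :
    notKet (encodeWord w ++ t).head? = true := by
  cases w <;> simp [encodeWord]

@[simp] lemma encodeWords_nil : encodeWords [] = [] := rfl
@[simp] lemma encodeWords_cons (w : Word) (l : List Word) :
    encodeWords (w :: l) = encodeWord w ++ encodeWords l := rfl
@[simp] lemma encodeWords_append (l l' : List Word) :
    encodeWords (l ++ l') = encodeWords l ++ encodeWords l' := List.flatMap_append
@[simp] lemma encodeClauses_nil : encodeClauses [] = [] := rfl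
@[simp] lemma encodeClauses_cons (c : Clause) (l : List Clause) :
    encodeClauses (c :: l) = encodeClause c ++ encodeClauses l := rfl
@[simp] lemma encodeClauses_append (l l' : List Clause) :
    encodeClauses (l ++ l') = encodeClauses l ++ encodeClauses l' := List.flatMap_append

/-- Descriptions of clauses end with a bracket. Hence removing characters from the work stack stops
exactly below the word that was copied last. -/
lemma isChar_head_reverse_encodeClauses (l : List Clause) :
    isChar (encodeClauses l).reverse.head? = false := by
  induction l using List.reverseRecOn with
  | nil => rfl
  | append_singleton l c => simp [encodeClause]

lemma isChar_head_reverse_encodeWord (w : Word) (t : List Γ') :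
    isChar ((encodeWord w).reverse ++ t).head? = false := by
  simp [encodeWord]

/-! #### The memory of the program -/

/-- The stacks of the program. -/
inductive Stack where
  /-- the input, and later the clauses that have to be treated -/
  | inp
  /-- the clauses that have been treated -/
  | work
  /-- the word to which other words are compared -/
  | key
  /-- a buffer -/
  | spare
  /-- the facts that have not been propagated yet -/
  | queue
  deriving DecidableEq

instance : Fintype Stack := ⟨{.inp, .work, .key, .spare, .queue}, fun k => by cases k <;> simp⟩

/-- The register of the program. -/
structure Register where
  /-- whether all comparisons succeeded -/
  same : Bool
  /-- whether the current clause has a premise -/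
  premise : Bool
  /-- whether the goal has been reached -/
  goal : Bool
  deriving Fintype

/-- The program type used below. -/
abbrev Program := Prog Γ' Stack Register

/-- The stacks with given contents. -/
def cells (I B V W Q : List Γ') : Stack → List Γ'
  | .inp => I
  | .work => B
  | .key => V
  | .spare => W
  | .queue => Q

section Cells

variable (I B V W Q x : List Γ')

@[simp] lemma cells_inp : cells I B V W Q .inp = I := rfl
@[simp] lemma cells_work : cells I B V W Q .work = B := rfl
@[simp] lemma cells_key : cells I B V W Q .key = V := rfl
@[simp] lemma cells_spare : cells I B V W Q .spare = W := rfl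
@[simp] lemma cells_queue : cells I B V W Q .queue = Q := rfl

@[simp] lemma update_inp : Function.update (cells I B V W Q) .inp x = cells x B V W Q := by
  funext k; cases k <;> rfl
@[simp] lemma update_work : Function.update (cells I B V W Q) .work x = cells I x V W Q := by
  funext k; cases k <;> rfl
@[simp] lemma update_key : Function.update (cells I B V W Q) .key x = cells I B x W Q := by
  funext k; cases k <;> rfl
@[simp] lemma update_spare : Function.update (cells I B V W Q) .spare x = cells I B V x Q := by
  funext k; cases k <;> rfl
@[simp] lemma update_queue : Function.update (cells I B V W Q) .queue x = cells I B V W x := by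
  funext k; cases k <;> rfl

end Cells

/-- The memory with given contents. -/
abbrev mem (f g a : Bool) (I B V W Q : List Γ') : Mem Γ' Stack Register :=
  (⟨f, g, a⟩, cells I B V W Q)

variable {f g a : Bool} {I B V W Q : List Γ'}

/-! #### Comparing a word to the key -/

/-- Move a word from the input to the work stack and compare it to the key. The comma after the
word is removed. -/
def compareWord : Program :=
  .loop .inp isChar (.acts
    [.look .inp .key fun r x y => { r with same := r.same && x == y },
      .move .inp .work, .move .key .spare]) ⨾
  .acts [.look .key .key fun r x _ => { r with same := r.same && x.isNone }, .drop .inp] ⨾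
  moveWhile Option.isSome .spare .key

/-- The loop is driven by the input word alone, so it detects only whether that word is a prefix of
the key. The part of the key already compared is kept on the spare stack in order to restore the key
later. -/
lemma does_compare_loop (w v : Word) (I B W : List Γ') (f : Bool) :
    Does (.loop .inp isChar (.acts
      [.look .inp .key fun r x y => { r with same := r.same && x == y },
        .move .inp .work, .move .key .spare]))
      (mem f g a (encodeWord w ++ I) B (chars v) W Q)
      (mem (f && decide (w <+: v)) g a (Γ'.comma :: I) ((chars w).reverse ++ B)
        (chars (v.drop w.length)) ((chars (v.take w.length)).reverse ++ W) Q)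
      (2 * w.length + 1) := by
  induction w generalizing v B W f with
  | nil => simpa [encodeWord] using Does.loop_done (by simp)
  | cons x w ih =>
    rcases v with _ | ⟨y, v⟩
    -- The key is exhausted: comparing a symbol with no symbol fails, moving from the empty key has
    -- no effect, and the flag remains false.
    · refine Does.of_eq (Does.loop_step (by simp [encodeWord]) (Does.acts_of_eq ?_)
        (ih [] (charSymbol x :: B) W false)) ?_ (by simp; omega)
      · simp [Act.exec, encodeWord]
      · simp
    · refine Does.of_eq (Does.loop_step (by simp [encodeWord]) (Does.acts_of_eq ?_)
        (ih v (charSymbol x :: B) (charSymbol y :: W) (f && x == y))) ?_ (by simp; omega)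
      · have : (charSymbol x == charSymbol y) = (x == y) := by
          rw [Bool.eq_iff_iff, beq_iff_eq, beq_iff_eq, charSymbol_injective.eq_iff]
        simp [Act.exec, encodeWord, this]
      · simp [Bool.and_assoc, beq_eq_decide]

/-- Two words are equal if and only if the first is a prefix of the second and nothing of the second
remains; the final look at the key tests the latter. -/
lemma does_compareWord (w v : Word) :
    Does compareWord (mem f g a (encodeWord w ++ I) B (chars v) [] Q)
      (mem (f && decide (w = v)) g a I ((chars w).reverse ++ B) (chars v) [] Q)
      (4 * w.length + 3) := by
  have hflag : (f && decide (w <+: v) && (chars (v.drop w.length)).head?.isNone) =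
      (f && decide (w = v)) := by
    rw [Bool.and_assoc]
    congr 1
    rw [Bool.eq_iff_iff, Bool.and_eq_true, decide_eq_true_iff, decide_eq_true_iff]
    constructor
    · rintro ⟨⟨t, rfl⟩, h⟩
      rcases t with _ | ⟨y, t⟩ <;> simp_all
    · rintro rfl
      simp
  have h₁ := does_compare_loop (g := g) (a := a) (Q := Q) w v I B [] f
  have h₂ : Does (.acts [.look .key .key fun r x _ => { r with same := r.same && x.isNone },
      .drop .inp])
      (mem (f && decide (w <+: v)) g a (Γ'.comma :: I) ((chars w).reverse ++ B)
        (chars (v.drop w.length)) ((chars (v.take w.length)).reverse ++ []) Q)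
      (mem (f && decide (w = v)) g a I ((chars w).reverse ++ B)
        (chars (v.drop w.length)) (chars (v.take w.length)).reverse Q) 1 :=
    Does.acts_of_eq (by simp [Act.exec, ← hflag])
  have h₃ := does_moveWhile (b := Option.isSome) (k := Stack.spare) (l := .key) (by simp)
    (w := (chars (v.take w.length)).reverse) (t := []) (by simp) rfl
    (⟨f && decide (w = v), g, a⟩ : Register)
    (cells I ((chars w).reverse ++ B)
        (chars (v.drop w.length)) (chars (v.take w.length)).reverse Q) (by simp)
  have h₄ : chars (v.take w.length) ++ chars (v.drop w.length) = chars v := by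
    rw [chars, chars, ← List.map_append, List.take_append_drop, chars]
  refine Does.of_eq (h₁.seq (h₂.seq h₃)) ?_ ?_
  · simp [h₄]
  · simp; omega

/-! #### Copying words and closing clauses -/

/-- Remove a word from the input. -/
def skipWord : Program := dropWhile isChar .inp ⨾ .acts [.drop .inp]

lemma does_skipWord (w : Word) :
    Does skipWord (mem f g a (encodeWord w ++ I) B V W Q) (mem f g a I B V W Q)
      (2 * w.length + 2) := by
  have h₁ := does_dropWhile (b := isChar) (k := Stack.inp) (w := chars w) (t := Γ'.comma :: I)
    isChar_of_mem_chars rfl (⟨f, g, a⟩ : Register) (cells (encodeWord w ++ I) B V W Q)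
    (by simp [encodeWord])
  refine (h₁.seq (Does.acts_of_eq ?_)).mono ?_
  · simp [Act.exec]
  · simp

/-- Move a word and the comma after it from the input to the work stack. -/
def copyWord : Program :=
  moveWhile isChar .inp .work ⨾ .acts [.drop .inp, .push .work Γ'.comma]

lemma does_copyWord (w : Word) :
    Does copyWord (mem f g a (encodeWord w ++ I) B V W Q)
      (mem f g a I ((encodeWord w).reverse ++ B) V W Q) (2 * w.length + 2) := by
  have h₁ := does_moveWhile (b := isChar) (k := Stack.inp) (l := .work) (by simp)
    (w := chars w) (t := Γ'.comma :: I)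
    isChar_of_mem_chars rfl (⟨f, g, a⟩ : Register) (cells (encodeWord w ++ I) B V W Q)
    (by simp [encodeWord])
  refine (h₁.seq (Does.acts_of_eq ?_)).mono ?_
  · simp [Act.exec, encodeWord]
  · simp

/-- Finish a clause: if it has no premise, move its head to the queue. -/
def closeClause : Program :=
  .acts [.drop .inp] ⨾
  .ite .inp (fun r _ => r.premise) (.acts [.push .work Γ'.ket])
    (.acts [.drop .work, .push .queue Γ'.comma] ⨾ moveWhile isChar .work .queue) ⨾
  .acts [.look .inp .inp fun r _ _ => { r with premise := false }]

/-- Add a clause to a list of clauses with premises and a list of facts. -/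
def emit (s : List Clause × List Word) (c : Clause) : List Clause × List Word :=
  if c.2 = [] then (s.1, c.1 :: s.2) else (s.1 ++ [c], s.2)

/-- The head lies below the premises on the work stack. Without premises it is on top, and moving it
to the queue undoes the reversal caused by copying it. -/
lemma does_closeClause (s : List Clause × List Word) (c : Clause) :
    Does closeClause
      (mem f (!c.2.isEmpty) a (Γ'.ket :: I) ((encodeWords c.2).reverse ++
        ((encodeWord c.1).reverse ++ (encodeClauses s.1).reverse)) V W (encodeWords s.2))
      (mem f false a I (encodeClauses (emit s c).1).reverse V W (encodeWords (emit s c).2))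
      (2 * c.1.length + 5) := by
  obtain ⟨h, b⟩ := c
  have h₁ : Does (.acts [.drop .inp])
      (mem f (!b.isEmpty) a (Γ'.ket :: I) ((encodeWords b).reverse ++
        ((encodeWord h).reverse ++ (encodeClauses s.1).reverse)) V W (encodeWords s.2))
      (mem f (!b.isEmpty) a I ((encodeWords b).reverse ++
        ((encodeWord h).reverse ++ (encodeClauses s.1).reverse)) V W (encodeWords s.2)) 1 :=
    Does.acts_of_eq (by simp [Act.exec])
  rcases b with _ | ⟨w, b⟩
  · have h₂ : Does (.acts [.drop .work, .push .queue Γ'.comma])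
        (mem f false a I ((encodeWord h).reverse ++ (encodeClauses s.1).reverse) V W
          (encodeWords s.2))
        (mem f false a I ((chars h).reverse ++ (encodeClauses s.1).reverse) V W
          (Γ'.comma :: encodeWords s.2)) 1 :=
      Does.acts_of_eq (by simp [Act.exec, encodeWord])
    have h₃ := does_moveWhile (b := isChar) (k := Stack.work) (l := .queue) (by simp)
      (w := (chars h).reverse) (t := (encodeClauses s.1).reverse) isChar_of_mem_reverse_chars
      (isChar_head_reverse_encodeClauses _) (⟨f, false, a⟩ : Register)
      (cells I ((chars h).reverse ++ (encodeClauses s.1).reverse) V W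
          (Γ'.comma :: encodeWords s.2)) rfl
    have h₄ := Does.ite_false (k := Stack.inp) (b := fun r _ => r.premise)
      (p := .acts [.push .work Γ'.ket]) rfl (h₂.seq h₃)
    refine (h₁.seq (h₄.seq (Does.acts_of_eq ?_))).mono ?_
    · simp [Act.exec, emit, encodeWord]
    · simp; omega
  · have h₂ : Does (.acts [.push .work Γ'.ket])
        (mem f true a I ((encodeWords (w :: b)).reverse ++
          ((encodeWord h).reverse ++ (encodeClauses s.1).reverse)) V W (encodeWords s.2))
        (mem f true a I (Γ'.ket :: ((encodeWords (w :: b)).reverse ++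
          ((encodeWord h).reverse ++ (encodeClauses s.1).reverse))) V W (encodeWords s.2)) 1 :=
      Does.acts_of_eq (by simp [Act.exec])
    have h₄ := Does.ite_true (k := Stack.inp) (b := fun r _ => r.premise)
      (q := .acts [.drop .work, .push .queue Γ'.comma] ⨾ moveWhile isChar .work .queue) rfl h₂
    refine (h₁.seq (h₄.seq (Does.acts_of_eq ?_))).mono ?_
    · simp [Act.exec, emit, encodeClause]
    · simp
end StackProgram

namespace StackProgram

variable {f g a : Bool} {I B V W Q : List Γ'}

/-! #### Propagating a fact -/

/-- Copy a premise unless it equals the key. -/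
def filterPremise : Program :=
  compareWord ⨾ .ite .inp (fun r _ => r.same) (dropWhile isChar .work)
    (.acts [.push .work Γ'.comma,
      .look .inp .inp fun r _ _ => { r with same := true, premise := true }])

/-- The comparison has already copied the premise to the work stack. It is erased if it equals the
key, and completed by a comma otherwise; the hypothesis on `B` stops the erasure at the right place.
-/
lemma does_filterPremise (w v : Word) (hB : isChar B.head? = false) :
    Does filterPremise (mem true g a (encodeWord w ++ I) B (chars v) [] Q)
      (mem true (g || decide (w ≠ v)) a I
        ((encodeWords ([w].filter fun w => decide (w ≠ v))).reverse ++ B) (chars v) [] Q)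
      (6 * w.length + 6) := by
  have h₁ := does_compareWord (f := true) (g := g) (a := a) (I := I) (B := B) (Q := Q) w v
  by_cases hw : w = v
  · have h₂ := does_dropWhile (b := isChar) (k := Stack.work) (w := (chars w).reverse) (t := B)
      isChar_of_mem_reverse_chars hB (⟨true && decide (w = v), g, a⟩ : Register)
      (cells I ((chars w).reverse ++ B) (chars v) [] Q) rfl
    refine Does.of_eq (h₁.seq (Does.ite_true (by simp [hw]) h₂)) ?_ ?_
    · simp [hw]
    · simp; omega
  · refine Does.of_eq (h₁.seq (Does.ite_false (by simp [hw]) (Does.acts_of_eq rfl))) ?_ ?_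
    · simp [hw, Act.exec, encodeWord]
    · omega

lemma isChar_head_filter (w v : Word) (hB : isChar B.head? = false) :
    isChar ((encodeWords ([w].filter fun w => decide (w ≠ v))).reverse ++ B).head? = false := by
  by_cases hw : w = v
  · simpa [hw] using hB
  · simp [hw, encodeWord]

lemma does_filterPremises (l : List Word) (v : Word) (hB : isChar B.head? = false) :
    Does (.loop .inp notKet filterPremise)
      (mem true g a (encodeWords l ++ Γ'.ket :: I) B (chars v) [] Q)
      (mem true (g || !(l.filter fun w => decide (w ≠ v)).isEmpty) a (Γ'.ket :: I)
        ((encodeWords (l.filter fun w => decide (w ≠ v))).reverse ++ B) (chars v) [] Q)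
      (7 * (encodeWords l).length + 1) := by
  induction l generalizing g B with
  | nil => simpa using Does.loop_done (by simp)
  | cons w l ih =>
    refine Does.of_eq (Does.loop_step
      (by simpa using notKet_head_encodeWord w (encodeWords l ++ Γ'.ket :: I))
      (Does.of_eq (does_filterPremise w v hB) rfl le_rfl |> (by simpa using ·))
      (ih (isChar_head_filter w v hB))) ?_ ?_
    · by_cases hw : w = v <;> simp [hw]
    · simp; omega

/-- Remove the key from the premises of a clause. -/
def filterClause : Program :=
  copyWord ⨾ .loop .inp notKet filterPremise ⨾ closeClause

/-- Remove a word from the premises of a clause. -/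
def removePremise (v : Word) (c : Clause) : Clause := (c.1, c.2.filter fun w => decide (w ≠ v))

lemma does_filterClause (v : Word) (c : Clause) (s : List Clause × List Word) :
    Does filterClause
      (mem true false a (encodeClause c ++ I) (encodeClauses s.1).reverse (chars v) []
        (encodeWords s.2))
      (mem true false a I (encodeClauses (emit s (removePremise v c)).1).reverse (chars v) []
        (encodeWords (emit s (removePremise v c)).2))
      (8 * (encodeClause c).length) := by
  have h₁ := does_copyWord (f := true) (g := false) (a := a)
    (I := encodeWords c.2 ++ Γ'.ket :: I) (B := (encodeClauses s.1).reverse) (V := chars v)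
    (W := []) (Q := encodeWords s.2) c.1
  have h₂ := does_filterPremises (g := false) (a := a) (I := I) (Q := encodeWords s.2) c.2 v
    (isChar_head_reverse_encodeWord c.1 (encodeClauses s.1).reverse)
  have h₃ := does_closeClause (f := true) (a := a) (I := I) (V := chars v) (W := []) s
    (removePremise v c)
  rw [Bool.false_or] at h₂
  have h : encodeClause c ++ I = encodeWord c.1 ++ (encodeWords c.2 ++ Γ'.ket :: I) := by
    simp [encodeClause]
  rw [h]
  refine Does.of_eq (h₁.seq (h₂.seq h₃)) rfl ?_
  simp [encodeClause, removePremise]; omega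

/-- The effect of a fact on a list of clauses. -/
def propagate (v : Word) (l : List Clause) (s : List Clause × List Word) :
    List Clause × List Word :=
  (l.map (removePremise v)).foldl emit s

lemma head_encodeClause (c : Clause) (I : List Γ') :
    Option.isSome (encodeClause c ++ I).head? = true := by
  simp [encodeClause, encodeWord]

lemma does_filterClauses (v : Word) (l : List Clause) (s : List Clause × List Word) :
    Does (.loop .inp Option.isSome filterClause)
      (mem true false a (encodeClauses l) (encodeClauses s.1).reverse (chars v) []
        (encodeWords s.2))
      (mem true false a [] (encodeClauses (propagate v l s).1).reverse (chars v) []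
        (encodeWords (propagate v l s).2))
      (9 * (encodeClauses l).length + 1) := by
  induction l generalizing s with
  | nil => exact Does.loop_done rfl
  | cons c l ih =>
    refine Does.of_eq (Does.loop_step (head_encodeClause c _) (does_filterClause v c s)
      (ih (emit s (removePremise v c)))) rfl ?_
    simp [encodeClause]; omega

/-- The size of the descriptions of clauses and facts. -/
def size (s : List Clause × List Word) : ℕ :=
  (encodeClauses s.1).length + (encodeWords s.2).length

lemma size_emit (s : List Clause × List Word) (c : Clause) :
    size (emit s c) ≤ size s + (encodeClause c).length := by
  unfold emit
  split_ifs <;> simp [size, encodeClause] <;> omega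

lemma length_encodeWords_filter (p : Word → Bool) (l : List Word) :
    (encodeWords (l.filter p)).length ≤ (encodeWords l).length := by
  induction l with
  | nil => simp
  | cons w l ih => by_cases h : p w = true <;> simp [h] <;> omega

lemma length_removePremise (v : Word) (c : Clause) :
    (encodeClause (removePremise v c)).length ≤ (encodeClause c).length := by
  have := length_encodeWords_filter (fun w => decide (w ≠ v)) c.2
  simp only [encodeClause, removePremise, List.length_append]
  omega

lemma size_foldl_emit (l : List Clause) (s : List Clause × List Word) :
    size (l.foldl emit s) ≤ size s + (encodeClauses l).length := by
  induction l generalizing s with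
  | nil => simp
  | cons c l ih =>
    have h₁ := ih (emit s c)
    have h₂ := size_emit s c
    simp only [List.foldl_cons, encodeClauses_cons, List.length_append]
    omega

/-- Removing premises shortens a clause, and a clause that turns into a fact keeps only its head.
All rounds therefore work on data no larger than the original. -/
lemma size_propagate (v : Word) (l : List Clause) (q : List Word) :
    size (propagate v l ([], q)) ≤ size (l, q) := by
  have h₁ := size_foldl_emit (l.map (removePremise v)) ([], q)
  have h₂ : (encodeClauses (l.map (removePremise v))).length ≤ (encodeClauses l).length := by
    induction l with
    | nil => simp
    | cons c l ih =>
      have h₃ := length_removePremise v c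
      have h₄ := ih (size_foldl_emit _ _)
      simp only [List.map_cons, encodeClauses_cons, List.length_append]
      omega
  simp only [propagate, size, encodeClauses_nil, List.length_nil] at *
  omega

/-- Take a fact from the queue and remove it from all clauses. -/
def propagateFact : Program :=
  moveWhile isChar .queue .spare ⨾ .acts [.drop .queue] ⨾
  moveWhile Option.isSome .spare .key ⨾
  .acts [.look .key .key fun r x _ => { r with goal := r.goal || x == some Γ'.blank }] ⨾
  .loop .inp Option.isSome filterClause ⨾
  dropWhile Option.isSome .key ⨾
  moveWhile Option.isSome .work .inp

lemma does_propagateFact (v : Word) (l : List Clause) (q : List Word) :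
    Does propagateFact (mem true false a (encodeClauses l) [] [] [] (encodeWords (v :: q)))
      (mem true false (a || v.head? == some none) (encodeClauses (propagate v l ([], q)).1) [] [] []
        (encodeWords (propagate v l ([], q)).2))
      (11 * size (l, v :: q) + 7) := by
  have h₁ := does_moveWhile (b := isChar) (k := Stack.queue) (l := .spare) (by simp)
    (w := chars v) (t := Γ'.comma :: encodeWords q) isChar_of_mem_chars rfl
    (⟨true, false, a⟩ : Register) (cells (encodeClauses l) [] [] [] (encodeWords (v :: q)))
    (by simp [encodeWord])
  have h₂ : Does (.acts [.drop .queue])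
      (mem true false a (encodeClauses l) [] [] (chars v).reverse (Γ'.comma :: encodeWords q))
      (mem true false a (encodeClauses l) [] [] (chars v).reverse (encodeWords q)) 1 :=
    Does.acts_of_eq (by simp [Act.exec])
  have h₃ := does_moveWhile (b := Option.isSome) (k := Stack.spare) (l := .key) (by simp)
    (w := (chars v).reverse) (t := []) (by simp) rfl
    (⟨true, false, a⟩ : Register)
    (cells (encodeClauses l) [] [] (chars v).reverse (encodeWords q)) (by simp)
  have h₄ : Does
      (.acts [.look .key .key fun r x _ => { r with goal := r.goal || x == some Γ'.blank }])
      (mem true false a (encodeClauses l) [] (chars v) [] (encodeWords q))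
      (mem true false (a || v.head? == some none) (encodeClauses l) [] (chars v) []
        (encodeWords q)) 1 :=
    Does.acts_of_eq (by rcases v with _ | ⟨_ | b, v⟩ <;> simp [Act.exec, charSymbol])
  have h₅ := does_filterClauses (a := a || v.head? == some none) v l ([], q)
  have h₆ := does_dropWhile (b := Option.isSome) (k := Stack.key) (w := chars v) (t := [])
    (by simp) rfl (⟨true, false, a || v.head? == some none⟩ : Register)
    (cells [] (encodeClauses (propagate v l ([], q)).1).reverse (chars v) []
        (encodeWords (propagate v l ([], q)).2)) (by simp)
  have h₇ := does_moveWhile (b := Option.isSome) (k := Stack.work) (l := .inp) (by simp)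
    (w := (encodeClauses (propagate v l ([], q)).1).reverse) (t := []) (by simp) rfl
    (⟨true, false, a || v.head? == some none⟩ : Register)
    (cells [] (encodeClauses (propagate v l ([], q)).1).reverse [] []
        (encodeWords (propagate v l ([], q)).2)) (by simp)
  simp only [update_queue, update_spare, update_key, update_inp, update_work, cells_spare,
    cells_key, cells_inp, List.append_nil, List.reverse_reverse] at h₁ h₃ h₆ h₇
  refine Does.of_eq (h₁.seq (h₂.seq (h₃.seq (h₄.seq (h₅.seq (h₆.seq h₇)))))) rfl ?_
  have h₈ := size_propagate v l q
  simp only [size, encodeWords_cons, List.length_append, length_encodeWord, List.length_reverse,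
    length_chars] at *
  omega

/-! #### Saturation -/

/-- The number of clauses and facts. -/
def count (s : List Clause × List Word) : ℕ := s.1.length + s.2.length

lemma count_foldl_emit (l : List Clause) (s : List Clause × List Word) :
    count (l.foldl emit s) = count s + l.length := by
  induction l generalizing s with
  | nil => simp
  | cons c l ih =>
    rw [List.foldl_cons, ih, List.length_cons]
    unfold emit
    split_ifs <;> simp [count] <;> omega

/-- Every clause survives as a clause or as a fact, while the propagated fact disappears. This
bounds the number of rounds. -/
lemma count_propagate (v : Word) (l : List Clause) (q : List Word) :
    count (propagate v l ([], q)) < count (l, v :: q) := by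
  rw [propagate, count_foldl_emit]
  simp [count]
  omega

/-- Whether the propagation of all facts reaches a word that begins with a blank. -/
def saturate (b : Bool) : List Clause × List Word → Bool
  | (_, []) => b
  | (l, v :: q) => saturate (b || v.head? == some none) (propagate v l ([], q))
termination_by s => count s
decreasing_by exact count_propagate v l q

lemma count_le_size (s : List Clause × List Word) : count s ≤ size s := by
  obtain ⟨l, q⟩ := s
  have h₁ : l.length ≤ (encodeClauses l).length := by
    induction l with
    | nil => simp
    | cons c l ih => simp [encodeClause]; omega
  have h₂ : q.length ≤ (encodeWords q).length := by
    induction q with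
    | nil => simp
    | cons w q ih => simp; omega
  exact add_le_add h₁ h₂

/-- The bound `N` is fixed across the rounds, which is possible because sizes do not grow. Clauses
whose premises were never all derived are left over on the input stack. -/
lemma does_propagateFacts (s : List Clause × List Word) (N : ℕ) (hN : size s ≤ N) (a : Bool) :
    ∃ l : List Clause, (encodeClauses l).length ≤ N ∧
    Does (.loop .queue Option.isSome propagateFact)
      (mem true false a (encodeClauses s.1) [] [] [] (encodeWords s.2))
      (mem true false (saturate a s) (encodeClauses l) [] [] [] [])
      ((11 * N + 8) * count s + 1) := by
  induction h : count s using Nat.strong_induction_on generalizing s a with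
  | _ n ih =>
    subst h
    obtain ⟨l, _ | ⟨v, q⟩⟩ := s
    · refine ⟨l, by simp [size] at hN; omega, ?_⟩
      rw [saturate]
      exact (Does.loop_done rfl).mono (by omega)
    · have hc := count_propagate v l q
      have hs := size_propagate v l q
      have hs' : size (l, q) ≤ size (l, v :: q) := by simp [size]
      obtain ⟨l', hl', h⟩ := ih _ hc (propagate v l ([], q)) (by omega)
        (a || v.head? == some none) rfl
      refine ⟨l', hl', ?_⟩
      rw [saturate]
      refine Does.of_eq (Does.loop_step (by simp [encodeWord]) (does_propagateFact v l q) h)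
        rfl ?_
      -- The count drops by `d + 1`. One unit pays `11 * N + 8` for the round and its loop test; the
      -- other `d` units are slack.
      obtain ⟨d, hd⟩ := Nat.exists_eq_add_of_lt hc
      rw [hd]
      have : (11 * N + 8) * (count (propagate v l ([], q)) + d + 1) =
        (11 * N + 8) * count (propagate v l ([], q)) + (11 * N + 8) * d + (11 * N + 8) := by ring
      rw [this]
      have := Nat.zero_le ((11 * N + 8) * d)
      omega

/-- Propagate all facts, and clean up. -/
def propagateFacts : Program :=
  .loop .queue Option.isSome propagateFact ⨾ dropWhile Option.isSome .inp

lemma does_saturate (s : List Clause × List Word) :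
    Does propagateFacts (mem true false false (encodeClauses s.1) [] [] [] (encodeWords s.2))
      (mem true false (saturate false s) [] [] [] [] []) (12 * (size s + 1) ^ 2) := by
  obtain ⟨l, hl, h⟩ := does_propagateFacts s (size s) le_rfl false
  have h' := does_dropWhile (b := Option.isSome) (k := Stack.inp) (w := encodeClauses l) (t := [])
    (by simp) rfl (⟨true, false, saturate false s⟩ : Register)
    (cells (encodeClauses l) [] [] [] []) (by simp)
  refine Does.of_eq (h.seq h') (by simp) ?_
  have := count_le_size s
  nlinarith

/-! #### Correctness of the propagation -/

/-- The words that can be derived from clauses and facts. -/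
inductive Derivable (l : List Clause) (q : List Word) : Word → Prop
  /-- facts can be derived -/
  | fact {w : Word} (h : w ∈ q) : Derivable l q w
  /-- the head of a clause can be derived if all the premises can be derived -/
  | clause {c : Clause} (h : c ∈ l) (hc : ∀ w ∈ c.2, Derivable l q w) : Derivable l q c.1

/-- This form covers more than inclusions of systems: it suffices that the facts and clauses of the
first system are admissible in the second. -/
lemma Derivable.mono {l l' : List Clause} {q q' : List Word}
    (hq : ∀ w ∈ q, Derivable l' q' w)
    (hl : ∀ c ∈ l, (∀ w ∈ c.2, Derivable l' q' w) → Derivable l' q' c.1)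
    {w : Word} (h : Derivable l q w) : Derivable l' q' w := by
  induction h with
  | fact h => exact hq _ h
  | clause h _ ih => exact hl _ h ih

lemma mem_foldl_emit_fst {l : List Clause} {s : List Clause × List Word} {c : Clause} :
    c ∈ (l.foldl emit s).1 ↔ c ∈ s.1 ∨ c ∈ l ∧ c.2 ≠ [] := by
  induction l generalizing s with
  | nil => simp
  | cons d l ih =>
    rw [List.foldl_cons, ih, emit]
    split_ifs with h
    · simp only [List.mem_cons]
      constructor
      · tauto
      · rintro (h' | ⟨rfl | h', h''⟩) <;> tauto
    · simp only [List.mem_append, List.mem_cons, List.not_mem_nil, or_false]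
      constructor
      · rintro ((h' | rfl) | h') <;> tauto
      · tauto

lemma mem_foldl_emit_snd {l : List Clause} {s : List Clause × List Word} {w : Word} :
    w ∈ (l.foldl emit s).2 ↔ w ∈ s.2 ∨ ∃ c ∈ l, c.2 = [] ∧ c.1 = w := by
  induction l generalizing s with
  | nil => simp
  | cons d l ih =>
    rw [List.foldl_cons, ih, emit]
    split_ifs with h
    · simp only [List.mem_cons, exists_eq_or_imp, h, true_and]
      tauto
    · simp only [List.mem_cons, exists_eq_or_imp, h, false_and, false_or]

/-- A clause without premises has the same consequences as the fact that is its head. -/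
lemma derivable_foldl_emit {l : List Clause} {s : List Clause × List Word} {w : Word} :
    Derivable (l.foldl emit s).1 (l.foldl emit s).2 w ↔ Derivable (s.1 ++ l) s.2 w := by
  constructor
  · refine Derivable.mono (fun w hw => ?_) fun c hc h => ?_
    · rcases mem_foldl_emit_snd.1 hw with h | ⟨c, hc, h, rfl⟩
      · exact .fact h
      · exact .clause (List.mem_append_right _ hc) (by simp [h])
    · refine .clause ?_ h
      rcases mem_foldl_emit_fst.1 hc with h | h
      · exact List.mem_append_left _ h
      · exact List.mem_append_right _ h.1
  · refine Derivable.mono (fun w hw => .fact (mem_foldl_emit_snd.2 (.inl hw))) fun c hc h => ?_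
    rcases List.mem_append.1 hc with hc | hc
    · exact .clause (mem_foldl_emit_fst.2 (.inl hc)) h
    · by_cases hc' : c.2 = []
      · exact .fact (mem_foldl_emit_snd.2 (.inr ⟨c, hc, hc', rfl⟩))
      · exact .clause (mem_foldl_emit_fst.2 (.inr ⟨hc, hc'⟩)) h

/-- This is unit resolution: a known fact may be deleted from all premises. The fact itself leaves
the system, hence the separate alternative `w = v`. -/
lemma derivable_propagate {v : Word} {l : List Clause} {q : List Word} {w : Word} :
    Derivable l (v :: q) w ↔
      w = v ∨ Derivable (propagate v l ([], q)).1 (propagate v l ([], q)).2 w := by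
  rw [propagate, derivable_foldl_emit, List.nil_append]
  constructor
  · intro h
    induction h with
    | fact h =>
      rcases List.mem_cons.1 h with h | h
      · exact .inl h
      · exact .inr (.fact h)
    | @clause c h _ ih =>
      refine .inr (Derivable.clause (c := removePremise v c) (List.mem_map_of_mem h) ?_)
      intro w hw
      simp only [removePremise, List.mem_filter, decide_eq_true_eq] at hw
      exact (ih w hw.1).resolve_left hw.2
  · rintro (rfl | h)
    · exact .fact (by simp)
    · refine Derivable.mono (fun w hw => .fact (by simp [hw])) (fun c hc h => ?_) h
      obtain ⟨c, hc', rfl⟩ := List.mem_map.1 hc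
      refine Derivable.clause (c := c) hc' fun w hw => ?_
      by_cases hv : w = v
      · exact .fact (by simp [hv])
      · exact h w (by simp [removePremise, hw, hv])

/-- Since every clause has a premise, nothing is derivable once the queue is empty. `emit` maintains
this condition by turning clauses without premises into facts. -/
lemma saturate_iff (s : List Clause × List Word) (b : Bool) (hs : ∀ c ∈ s.1, c.2 ≠ []) :
    saturate b s = true ↔ b = true ∨ ∃ w, Derivable s.1 s.2 w ∧ w.head? = some none := by
  induction h : count s using Nat.strong_induction_on generalizing s b with
  | _ n ih =>
    subst h
    obtain ⟨l, _ | ⟨v, q⟩⟩ := s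
    · have h : ∀ w, ¬ Derivable l [] w := by
        intro w h
        induction h with
        | fact h => simp at h
        | @clause c h _ ih =>
          obtain ⟨w, hw⟩ := List.exists_mem_of_ne_nil _ (hs c h)
          exact ih w hw
      simp [saturate, h]
    · rw [saturate, ih _ (count_propagate v l q) _ _ ?_ rfl]
      · simp only [derivable_propagate, Bool.or_eq_true, beq_iff_eq, or_and_right, exists_or,
          exists_eq_left, or_assoc]
      · intro c hc
        rw [propagate, mem_foldl_emit_fst] at hc
        simp_all

lemma saturate_foldl_emit (l : List Clause) :
    saturate false (l.foldl emit ([], [])) = true ↔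
      ∃ w, Derivable l [] w ∧ w.head? = some none := by
  rw [saturate_iff _ _ fun c hc => by simpa using ((mem_foldl_emit_fst.1 hc).resolve_left (by simp)).2]
  simp [derivable_foldl_emit]

end StackProgram

namespace StackProgram

variable {f g a : Bool} {I B V W Q : List Γ'}

/-! #### Reading the input -/

/-- A symbol of a rule: a name, or a letter with a nonempty list of entries. -/
inductive Token where
  /-- a name -/
  | name (w : Word)
  /-- a letter with its first entry and its other entries -/
  | letter (v : Word) (l : List Word)

/-- The description of a symbol of a rule. -/
def encodeToken : Token → List Γ'
  | .name w => encodeWord w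
  | .letter v l => Γ'.bra :: (encodeWord v ++ encodeWords l ++ [Γ'.ket])

/-- The premises that a symbol of a rule contributes to a clause: letters with equal entries
contribute nothing, other letters contribute a premise that is the head of no rule. -/
def Token.premises : Token → List Word
  | .name w => [w]
  | .letter v l => if ∀ w ∈ l, w = v then [] else [[none]]

/-- The description of a list of symbols. -/
def encodeTokens (l : List Token) : List Γ' := l.flatMap encodeToken

@[simp] lemma encodeTokens_nil : encodeTokens [] = [] := rfl
@[simp] lemma encodeTokens_cons (t : Token) (l : List Token) :
    encodeTokens (t :: l) = encodeToken t ++ encodeTokens l := rfl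

/-- Compare the remaining entries of a letter to the first one. -/
def compareEntries : Program := .loop .inp notKet (compareWord ⨾ dropWhile isChar .work)

/-- Comparing leaves a copy of each entry on the work stack, which is discarded at once; only the
flag matters. -/
lemma does_compareEntries (v : Word) (l : List Word) (f : Bool) (hB : isChar B.head? = false) :
    Does compareEntries (mem f g a (encodeWords l ++ Γ'.ket :: I) B (chars v) [] Q)
      (mem (f && decide (∀ w ∈ l, w = v)) g a (Γ'.ket :: I) B (chars v) [] Q)
      (6 * (encodeWords l).length + 1) := by
  unfold compareEntries
  induction l generalizing f with
  | nil => simpa using Does.loop_done (by simp)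
  | cons w l ih =>
    have h₁ := does_compareWord (f := f) (g := g) (a := a) (Q := Q)
      (I := encodeWords l ++ Γ'.ket :: I) (B := B) w v
    have h₂ := does_dropWhile (b := isChar) (k := Stack.work) (w := (chars w).reverse) (t := B)
      isChar_of_mem_reverse_chars hB (⟨f && decide (w = v), g, a⟩ : Register)
      (cells (encodeWords l ++ Γ'.ket :: I) ((chars w).reverse ++ B) (chars v) [] Q) rfl
    simp only [update_work] at h₂
    have h₃ := ih (f && decide (w = v))
    rw [encodeWords_cons, List.append_assoc]
    refine Does.of_eq (Does.loop_step (notKet_head_encodeWord w _) (h₁.seq h₂) h₃) ?_ ?_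
    · simp [Bool.and_assoc]
    · simp; omega

/-- Read a letter. -/
def readLetter : Program :=
  .acts [.drop .inp] ⨾ moveWhile isChar .inp .spare ⨾ .acts [.drop .inp] ⨾
  moveWhile Option.isSome .spare .key ⨾ compareEntries ⨾ .acts [.drop .inp] ⨾
  dropWhile Option.isSome .key ⨾
  .ite .inp (fun r _ => r.same) (.acts [])
    (.acts [.push .work Γ'.blank, .push .work Γ'.comma,
      .look .inp .inp fun r _ _ => { r with same := true, premise := true }])

lemma does_readLetter (v : Word) (l : List Word) (hB : isChar B.head? = false) :
    Does readLetter (mem true g a (encodeToken (.letter v l) ++ I) B [] [] Q)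
      (mem true (g || !(Token.letter v l).premises.isEmpty) a I
        ((encodeWords (Token.letter v l).premises).reverse ++ B) [] [] Q)
      (6 * (encodeToken (.letter v l)).length) := by
  have h₁ : Does (.acts [.drop .inp])
      (mem true g a (encodeToken (.letter v l) ++ I) B [] [] Q)
      (mem true g a (chars v ++ Γ'.comma :: (encodeWords l ++ Γ'.ket :: I)) B [] [] Q) 1 :=
    Does.acts_of_eq (by simp [Act.exec, encodeToken, encodeWord])
  have h₂ := does_moveWhile (b := isChar) (k := Stack.inp) (l := .spare) (by simp)
    (w := chars v) (t := Γ'.comma :: (encodeWords l ++ Γ'.ket :: I)) isChar_of_mem_chars rfl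
    (⟨true, g, a⟩ : Register)
    (cells (chars v ++ Γ'.comma :: (encodeWords l ++ Γ'.ket :: I)) B [] [] Q) rfl
  have h₃ : Does (.acts [.drop .inp])
      (mem true g a (Γ'.comma :: (encodeWords l ++ Γ'.ket :: I)) B [] (chars v).reverse Q)
      (mem true g a (encodeWords l ++ Γ'.ket :: I) B [] (chars v).reverse Q) 1 :=
    Does.acts_of_eq (by simp [Act.exec])
  have h₄ := does_moveWhile (b := Option.isSome) (k := Stack.spare) (l := .key) (by simp)
    (w := (chars v).reverse) (t := []) (by simp) rfl (⟨true, g, a⟩ : Register)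
    (cells (encodeWords l ++ Γ'.ket :: I) B [] (chars v).reverse Q) (by simp)
  have h₅ := does_compareEntries (g := g) (a := a) (I := I) (Q := Q) v l true hB
  have h₆ : Does (.acts [.drop .inp])
      (mem (true && decide (∀ w ∈ l, w = v)) g a (Γ'.ket :: I) B (chars v) [] Q)
      (mem (true && decide (∀ w ∈ l, w = v)) g a I B (chars v) [] Q) 1 :=
    Does.acts_of_eq (by simp [Act.exec])
  have h₇ := does_dropWhile (b := Option.isSome) (k := Stack.key) (w := chars v) (t := [])
    (by simp) rfl (⟨true && decide (∀ w ∈ l, w = v), g, a⟩ : Register)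
    (cells I B (chars v) [] Q) (by simp)
  simp only [update_spare, update_key, update_inp, cells_spare, cells_key, List.append_nil,
    List.reverse_reverse] at h₂ h₄ h₇
  have h₈ : Does (.ite .inp (fun r _ => r.same) (.acts [])
      (.acts [.push .work Γ'.blank, .push .work Γ'.comma,
        .look .inp .inp fun r _ _ => { r with same := true, premise := true }]))
      (mem (true && decide (∀ w ∈ l, w = v)) g a I B [] [] Q)
      (mem true (g || !(Token.letter v l).premises.isEmpty) a I
        ((encodeWords (Token.letter v l).premises).reverse ++ B) [] [] Q) 2 := by
    by_cases h : ∀ w ∈ l, w = v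
    · refine Does.ite_true (by simpa using h) (Does.acts_of_eq ?_)
      have h' : (true && decide (∀ w ∈ l, w = v)) = true := by simpa using h
      rw [h', Token.premises, if_pos h]
      simp
    · refine Does.ite_false (by simpa using h) (Does.acts_of_eq ?_)
      rw [Token.premises, if_neg h]
      simp [Act.exec, encodeWord, chars, charSymbol]
  refine Does.of_eq (h₁.seq (h₂.seq (h₃.seq (h₄.seq (h₅.seq (h₆.seq (h₇.seq h₈))))))) rfl ?_
  simp [encodeToken]
  omega

/-- Whether a symbol opens a bracket. -/
def isBra : Option Γ' → Bool
  | some Γ'.bra => true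
  | _ => false

lemma isBra_head_encodeWord (w : Word) (t : List Γ') :
    isBra (encodeWord w ++ t).head? = false := by
  rcases w with _ | ⟨_ | b, w⟩ <;> rfl

/-- Read a symbol of a rule. -/
def readToken : Program :=
  .ite .inp (fun _ x => isBra x) readLetter
    (copyWord ⨾ .acts [.look .inp .inp fun r _ _ => { r with premise := true }])

lemma does_readToken (t : Token) (hB : isChar B.head? = false) :
    Does readToken (mem true g a (encodeToken t ++ I) B [] [] Q)
      (mem true (g || !t.premises.isEmpty) a I ((encodeWords t.premises).reverse ++ B) [] [] Q)
      (7 * (encodeToken t).length) := by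
  cases t with
  | name w =>
    have h₁ := does_copyWord (f := true) (g := g) (a := a) (I := I) (B := B) (V := []) (W := [])
      (Q := Q) w
    refine Does.of_eq (Does.ite_false (isBra_head_encodeWord w I)
      (h₁.seq (Does.acts_of_eq rfl))) ?_ ?_
    · simp [Act.exec, Token.premises]
    · simp [encodeToken]; omega
  | letter v l =>
    refine Does.of_eq (Does.ite_true rfl (does_readLetter v l hB)) rfl ?_
    simp [encodeToken]

lemma isChar_head_premises (t : Token) (hB : isChar B.head? = false) :
    isChar ((encodeWords t.premises).reverse ++ B).head? = false := by
  cases t with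
  | name w => simp [Token.premises, encodeWord]
  | letter v l =>
    rw [Token.premises]
    split_ifs
    · simpa using hB
    · simp [encodeWord]

lemma notKet_head_encodeToken (t : Token) (I : List Γ') :
    notKet (encodeToken t ++ I).head? = true := by
  cases t with
  | name w => exact notKet_head_encodeWord w I
  | letter v l => rfl

lemma does_readTokens (l : List Token) (hB : isChar B.head? = false) :
    Does (.loop .inp notKet readToken)
      (mem true g a (encodeTokens l ++ Γ'.ket :: I) B [] [] Q)
      (mem true (g || !(l.flatMap Token.premises).isEmpty) a (Γ'.ket :: I)
        ((encodeWords (l.flatMap Token.premises)).reverse ++ B) [] [] Q)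
      (8 * (encodeTokens l).length + 1) := by
  induction l generalizing g B with
  | nil => simpa using Does.loop_done (by simp)
  | cons t l ih =>
    have h : 0 < (encodeToken t).length := by cases t <;> simp [encodeToken]
    rw [encodeTokens_cons, List.append_assoc]
    refine Does.of_eq (Does.loop_step (notKet_head_encodeToken t _)
      (does_readToken t hB) (ih (isChar_head_premises t hB))) ?_ ?_
    · rw [List.flatMap_cons]
      generalize t.premises = p
      cases p <;> simp
    · simp; omega

/-- A rule with its left-hand side and the symbols of its right-hand side. -/
abbrev TokenRule := Word × List Token

/-- The clause that corresponds to a rule. -/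
def toClause (r : TokenRule) : Clause := (r.1, r.2.flatMap Token.premises)

/-- The description of a rule. -/
def encodeTokenRule (r : TokenRule) : List Γ' :=
  Γ'.bra :: (encodeWord r.1 ++ encodeTokens r.2 ++ [Γ'.ket])

/-- The description of a list of rules. -/
def encodeTokenRules (l : List TokenRule) : List Γ' := l.flatMap encodeTokenRule

@[simp] lemma encodeTokenRules_nil : encodeTokenRules [] = [] := rfl
@[simp] lemma encodeTokenRules_cons (t : TokenRule) (l : List TokenRule) :
    encodeTokenRules (t :: l) = encodeTokenRule t ++ encodeTokenRules l := rfl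

/-- Read a rule. -/
def readRule : Program :=
  .acts [.drop .inp] ⨾ copyWord ⨾ .loop .inp notKet readToken ⨾ closeClause

lemma does_readRule (r : TokenRule) (s : List Clause × List Word) :
    Does readRule
      (mem true false a (encodeTokenRule r ++ I) (encodeClauses s.1).reverse [] []
        (encodeWords s.2))
      (mem true false a I (encodeClauses (emit s (toClause r)).1).reverse [] []
        (encodeWords (emit s (toClause r)).2))
      (8 * (encodeTokenRule r).length) := by
  have h₁ : Does (.acts [.drop .inp])
      (mem true false a (encodeTokenRule r ++ I) (encodeClauses s.1).reverse [] []
        (encodeWords s.2))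
      (mem true false a (encodeWord r.1 ++ (encodeTokens r.2 ++ Γ'.ket :: I))
        (encodeClauses s.1).reverse [] [] (encodeWords s.2)) 1 :=
    Does.acts_of_eq (by simp [Act.exec, encodeTokenRule])
  have h₂ := does_copyWord (f := true) (g := false) (a := a)
    (I := encodeTokens r.2 ++ Γ'.ket :: I) (B := (encodeClauses s.1).reverse) (V := [])
    (W := []) (Q := encodeWords s.2) r.1
  have h₃ := does_readTokens (g := false) (a := a) (I := I) (Q := encodeWords s.2) r.2
    (isChar_head_reverse_encodeWord r.1 (encodeClauses s.1).reverse)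
  have h₄ := does_closeClause (f := true) (a := a) (I := I) (V := []) (W := []) s (toClause r)
  rw [Bool.false_or] at h₃
  refine Does.of_eq (h₁.seq (h₂.seq (h₃.seq h₄))) rfl ?_
  simp [encodeTokenRule, toClause]
  omega

lemma does_readRules (l : List TokenRule) (s : List Clause × List Word) :
    Does (.loop .inp isBra readRule)
      (mem true false a (encodeTokenRules l) (encodeClauses s.1).reverse [] []
        (encodeWords s.2))
      (mem true false a [] (encodeClauses ((l.map toClause).foldl emit s).1).reverse [] []
        (encodeWords ((l.map toClause).foldl emit s).2))
      (9 * (encodeTokenRules l).length + 1) := by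
  induction l generalizing s with
  | nil => exact Does.loop_done rfl
  | cons r l ih =>
    have h : 0 < (encodeTokenRule r).length := by simp [encodeTokenRule]
    refine Does.of_eq (Does.loop_step rfl (does_readRule r s) (ih (emit s (toClause r)))) rfl ?_
    simp only [encodeTokenRules_cons, List.length_append]
    omega

/-- The artificial premise takes two symbols, a blank and a comma, whereas a letter has at least its
two brackets and a comma. -/
lemma length_premises (t : Token) :
    (encodeWords t.premises).length ≤ (encodeToken t).length := by
  cases t with
  | name w => simp [Token.premises, encodeToken]
  | letter v l =>
    rw [Token.premises]
    split_ifs <;> (simp [encodeToken]; try omega)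

lemma length_toClause (r : TokenRule) :
    (encodeClause (toClause r)).length ≤ (encodeTokenRule r).length := by
  obtain ⟨h, l⟩ := r
  have : (encodeWords (l.flatMap Token.premises)).length ≤ (encodeTokens l).length := by
    induction l with
    | nil => simp
    | cons t l ih =>
      have := length_premises t
      simp; omega
  simp [encodeClause, toClause, encodeTokenRule]
  omega

lemma length_map_toClause (l : List TokenRule) :
    (encodeClauses (l.map toClause)).length ≤ (encodeTokenRules l).length := by
  induction l with
  | nil => simp
  | cons r l ih =>
    have := length_toClause r
    simp; omega

/-- The description of a grammar: three numbers, the initial variable, a list of bits, and the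
rules. -/
def encodeInput (x y z v : Word) (b : List Bool) (l : List TokenRule) : List Γ' :=
  encodeWord x ++ (encodeWord y ++ (encodeWord z ++ (encodeWord v ++
    (chars (b.map some) ++ encodeTokenRules l))))

/-- The clauses of a grammar, with a clause whose head is a blank and whose premise is the initial
variable. -/
def inputClauses (v : Word) (l : List TokenRule) : List Clause :=
  ([none], [v]) :: l.map toClause

/-- Decide whether the initial variable of a grammar can be derived. -/
def mainProgram : Program :=
  skipWord ⨾ skipWord ⨾ skipWord ⨾
  .acts [.push .work Γ'.blank, .push .work Γ'.comma] ⨾ copyWord ⨾ .acts [.push .work Γ'.ket] ⨾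
  dropWhile isChar .inp ⨾ .loop .inp isBra readRule ⨾ moveWhile Option.isSome .work .inp ⨾
  propagateFacts

lemma does_mainProgram (x y z v : Word) (b : List Bool) (l : List TokenRule) :
    Does mainProgram (mem true false false (encodeInput x y z v b l) [] [] [] [])
      (mem true false (saturate false ((inputClauses v l).foldl emit ([], []))) [] [] [] [] [])
      (28 * ((encodeInput x y z v b l).length + 1) ^ 2) := by
  have h₁ := does_skipWord (f := true) (g := false) (a := false) (B := []) (V := []) (W := [])
    (Q := []) (I := encodeWord y ++ (encodeWord z ++ (encodeWord v ++
    (chars (b.map some) ++ encodeTokenRules l)))) x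
  have h₂ := does_skipWord (f := true) (g := false) (a := false) (B := []) (V := []) (W := [])
    (Q := []) (I := encodeWord z ++ (encodeWord v ++
    (chars (b.map some) ++ encodeTokenRules l))) y
  have h₃ := does_skipWord (f := true) (g := false) (a := false) (B := []) (V := []) (W := [])
    (Q := []) (I := encodeWord v ++ (chars (b.map some) ++ encodeTokenRules l)) z
  have h₄ : Does (.acts [.push .work Γ'.blank, .push .work Γ'.comma])
      (mem true false false (encodeWord v ++ (chars (b.map some) ++ encodeTokenRules l))
        [] [] [] [])
      (mem true false false (encodeWord v ++ (chars (b.map some) ++ encodeTokenRules l))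
        [Γ'.comma, Γ'.blank] [] [] []) 1 :=
    Does.acts_of_eq (by simp [Act.exec])
  have h₅ := does_copyWord (f := true) (g := false) (a := false)
    (I := chars (b.map some) ++ encodeTokenRules l) (B := [Γ'.comma, Γ'.blank]) (V := [])
    (W := []) (Q := []) v
  have h₆ : Does (.acts [.push .work Γ'.ket])
      (mem true false false (chars (b.map some) ++ encodeTokenRules l)
        ((encodeWord v).reverse ++ [Γ'.comma, Γ'.blank]) [] [] [])
      (mem true false false (chars (b.map some) ++ encodeTokenRules l)
        (encodeClauses [([none], [v])]).reverse [] [] []) 1 :=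
    Does.acts_of_eq (by simp [Act.exec, encodeClause, encodeWord, charSymbol])
  -- The quantifier bits have no terminator: they end at the opening bracket of the first rule or at
  -- the end of the input.
  have h₇ := does_dropWhile (b := isChar) (k := Stack.inp) (w := chars (b.map some))
    (t := encodeTokenRules l) isChar_of_mem_chars (by cases l <;> rfl)
    (⟨true, false, false⟩ : Register)
    (cells (chars (b.map some) ++ encodeTokenRules l)
        (encodeClauses [([none], [v])]).reverse [] [] []) rfl
  have h₈ := does_readRules (a := false) l (emit ([], []) ([none], [v]))
  generalize hs : (l.map toClause).foldl emit (emit ([], []) ([none], [v])) = s at h₈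
  have hs' : (inputClauses v l).foldl emit ([], []) = s := hs
  have h₉ := does_moveWhile (b := Option.isSome) (k := Stack.work) (l := .inp) (by simp)
    (w := (encodeClauses s.1).reverse) (t := []) (by simp) rfl
    (⟨true, false, false⟩ : Register)
    (cells [] (encodeClauses s.1).reverse [] [] (encodeWords s.2)) (by simp)
  have h₁₀ := does_saturate s
  simp only [update_work, update_inp, cells_inp, List.append_nil,
    List.reverse_reverse] at h₇ h₉
  rw [hs']
  refine Does.of_eq (h₁.seq (h₂.seq (h₃.seq (h₄.seq (h₅.seq (h₆.seq (h₇.seq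
    (h₈.seq (h₉.seq h₁₀))))))))) rfl ?_
  have hsize := size_foldl_emit (inputClauses v l) ([], [])
  rw [hs'] at hsize
  have hl := length_map_toClause l
  have hN : (encodeInput x y z v b l).length = x.length + y.length + z.length + v.length +
      b.length + (encodeTokenRules l).length + 4 := by
    simp [encodeInput]; omega
  rw [hN]
  -- The goal clause contributes `v.length + 4` symbols: a blank, the word `v`, two commas and a
  -- bracket.
  have hsize' : size s ≤ v.length + 4 + (encodeTokenRules l).length := by
    simp [inputClauses, size, encodeClause] at hsize hl ⊢
    omega
  have hwork : (encodeClauses s.1).reverse.length ≤ size s := by simp [size]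
  have hsq : (size s + 1) ^ 2 ≤ (x.length + y.length + z.length + v.length +
      b.length + (encodeTokenRules l).length + 4 + 1) ^ 2 := Nat.pow_le_pow_left (by omega) 2
  -- Saturation uses 12 of the 28 squares; this inequality lets the remaining ones absorb the phases
  -- of linear cost.
  have hlin : x.length + y.length + z.length + v.length +
      b.length + (encodeTokenRules l).length + 4 + 1 ≤ (x.length + y.length + z.length + v.length +
      b.length + (encodeTokenRules l).length + 4 + 1) ^ 2 := Nat.le_self_pow (by simp) _
  simp only [length_chars, List.length_map]
  omega

end StackProgram

/-! ### Context-free grammars -/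

namespace ContextFreeGrammar

variable {T : Type} {g : ContextFreeGrammar T}

/-- The grammar variables from which some word can be derived. -/
inductive Productive (g : ContextFreeGrammar T) : g.NT → Prop
  /-- the left-hand side of a rule is productive if all grammar variables on the right-hand side
  are productive -/
  | rule {r : ContextFreeRule T g.NT} (hr : r ∈ g.rules)
      (h : ∀ v, Symbol.nonterminal v ∈ r.output → Productive g v) : Productive g r.input

lemma productive_of_derives {u : List (Symbol T g.NT)} {w : List T}
    (h : g.Derives u (w.map Symbol.terminal)) :
    ∀ v, Symbol.nonterminal v ∈ u → g.Productive v := by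
  induction h using Relation.ReflTransGen.head_induction_on with
  | refl => simp
  | head h _ ih =>
    obtain ⟨r, hr, h⟩ := h
    obtain ⟨p, q, rfl, rfl⟩ := h.exists_parts
    intro v hv
    simp only [List.mem_append, List.mem_singleton, Symbol.nonterminal.injEq] at hv ih
    rcases hv with (hv | rfl) | hv
    · exact ih v (by tauto)
    · exact .rule hr fun v hv => ih v (by tauto)
    · exact ih v (by tauto)

lemma exists_derives_of_forall {u : List (Symbol T g.NT)}
    (h : ∀ v, Symbol.nonterminal v ∈ u →
      ∃ w : List T, g.Derives [Symbol.nonterminal v] (w.map Symbol.terminal)) :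
    ∃ w : List T, g.Derives u (w.map Symbol.terminal) := by
  induction u with
  | nil => exact ⟨[], .refl _⟩
  | cons a u ih =>
    obtain ⟨w, hw⟩ := ih fun v hv => h v (List.mem_cons_of_mem _ hv)
    have ha : ∃ w : List T, g.Derives [a] (w.map Symbol.terminal) := by
      cases a with
      | terminal a => exact ⟨[a], .refl _⟩
      | nonterminal v => exact h v (by simp)
    obtain ⟨w', hw'⟩ := ha
    refine ⟨w' ++ w, ?_⟩
    rw [List.map_append]
    exact (hw'.append_right u).trans (hw.append_left _)

lemma Productive.exists_derives {v : g.NT} (h : g.Productive v) :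
    ∃ w : List T, g.Derives [Symbol.nonterminal v] (w.map Symbol.terminal) := by
  induction h with
  | @rule r hr _ ih =>
    obtain ⟨w, hw⟩ := exists_derives_of_forall ih
    exact ⟨w, .head ⟨r, hr, .input_output⟩ hw⟩

theorem exists_mem_language_iff_productive :
    (∃ w, w ∈ g.language) ↔ g.Productive g.initial :=
  ⟨fun ⟨_, hw⟩ => productive_of_derives hw _ (by simp), fun h => h.exists_derives⟩

lemma Derives.terminal_mem {u v : List (Symbol T g.NT)} (h : g.Derives u v) {a : T}
    (ha : Symbol.terminal a ∈ u) : Symbol.terminal a ∈ v := by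
  induction h with
  | refl => exact ha
  | tail _ h ih =>
    obtain ⟨r, hr, h⟩ := h
    obtain ⟨p, q, rfl, rfl⟩ := h.exists_parts
    simp only [List.mem_append, List.mem_singleton, reduceCtorEq, or_false] at ih ⊢
    tauto

end ContextFreeGrammar

/-! ### Ranked grammars -/

section Ranks

variable {X A : Type} {g : ContextFreeGrammar (X → Option A)}

/-- Letters that can begin something derived from the first symbol of a right-hand side can also
begin something derived from the left-hand side, and ranks on the left are intersections. -/
lemma leftRank_subset {r : ContextFreeRule (X → Option A) g.NT} (hr : r ∈ g.rules)
    {a : Symbol (X → Option A) g.NT} {γ : List (Symbol (X → Option A) g.NT)}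
    (h : r.output = a :: γ) :
    leftRank g [Symbol.nonterminal r.input] ⊆ leftRank g [a] := by
  intro x hx σ δ hσ
  have h₁ : LeftEdge g [Symbol.nonterminal r.input] (a :: γ) := .inl ⟨r, hr, rfl, h.symm⟩
  cases a with
  | nonterminal v =>
    exact hx σ δ ((Relation.ReflTransGen.single h₁).trans (.head (.inr ⟨v, γ, rfl, rfl⟩) hσ))
  | terminal τ =>
    -- No edge leaves a single terminal, so `σ` is the terminal `τ` itself.
    rcases Relation.ReflTransGen.cases_head hσ with h' | ⟨_, h' | h', _⟩
    · simp only [List.cons.injEq, Symbol.terminal.injEq] at h'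
      exact hx σ γ (by rw [← h'.1]; exact .single h₁)
    · simp at h'
    · simp at h'

lemma rightRank_subset {r : ContextFreeRule (X → Option A) g.NT} (hr : r ∈ g.rules)
    {a : Symbol (X → Option A) g.NT} {γ : List (Symbol (X → Option A) g.NT)}
    (h : r.output = γ ++ [a]) :
    rightRank g [a] ⊆ rightRank g [Symbol.nonterminal r.input] := by
  rintro x ⟨σ, δ, hσ, hx⟩
  have h₁ : RightEdge g [Symbol.nonterminal r.input] (γ ++ [a]) := .inl ⟨r, hr, rfl, h.symm⟩
  cases a with
  | nonterminal v => exact ⟨σ, δ, .head h₁ (.head (.inr ⟨γ, v, rfl, rfl⟩) hσ), hx⟩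
  | terminal τ =>
    rcases Relation.ReflTransGen.cases_head hσ with h' | ⟨_, h' | h', _⟩
    · have : τ = σ := by
        have := congrArg List.getLast? h'
        simpa using this
      exact ⟨σ, γ, this ▸ .single h₁, hx⟩
    · simp at h'
    · obtain ⟨γ, v, h', -⟩ := h'
      have := congrArg List.getLast? h'
      simp at this

/-- Neighbouring symbols whose ranks are compatible. -/
def Compatible (g : ContextFreeGrammar (X → Option A)) (a b : Symbol (X → Option A) g.NT) : Prop :=
  rightRank g [a] ⊆ leftRank g [b]

lemma IsRanked.isChain_output (hg : IsRanked g) {r : ContextFreeRule (X → Option A) g.NT}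
    (hr : r ∈ g.rules) : r.output.IsChain (Compatible g) := by
  rw [List.isChain_iff_forall_rel_of_append_cons_cons]
  intro a b l₁ l₂ h
  exact hg r hr l₁ l₂ a b h

/-- New neighbours arise inside the inserted right-hand side, where rankedness applies, and at its
two ends, where the rank inclusions apply. An empty right-hand side would bring together two symbols
about which nothing is known. -/
lemma isChain_of_produces (hg : IsRanked g) (hε : ∀ r ∈ g.rules, r.output ≠ [])
    {u v : List (Symbol (X → Option A) g.NT)} (h : g.Produces u v)
    (hu : u.IsChain (Compatible g)) : v.IsChain (Compatible g) := by
  obtain ⟨r, hr, h⟩ := h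
  obtain ⟨p, q, rfl, rfl⟩ := h.exists_parts
  have hout := hg.isChain_output hr
  rw [List.append_assoc, List.isChain_append] at hu ⊢
  rw [List.isChain_append] at hu ⊢
  obtain ⟨hp, ⟨-, hq, hvq⟩, hpv⟩ := hu
  refine ⟨hp, ⟨hout, hq, ?_⟩, ?_⟩
  · intro a ha b hb
    obtain ⟨γ, hγ⟩ := List.getLast?_eq_some_iff.1 ha
    exact (rightRank_subset hr hγ).trans (hvq _ (by simp) b hb)
  · intro a ha b hb
    obtain ⟨c, γ, hγ⟩ := List.exists_cons_of_ne_nil (hε r hr)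
    rw [hγ] at hb
    obtain rfl : c = b := by simpa using hb
    exact (hpv a ha (Symbol.nonterminal r.input) (by simp)).trans (leftRank_subset hr hγ)

/-- In a word of a ranked grammar without empty right-hand sides, only `#` follows `#`. -/
theorem isChain_of_mem_language (hg : IsRanked g) (hε : ∀ r ∈ g.rules, r.output ≠ [])
    {w : List (X → Option A)} (hw : w ∈ g.language) :
    w.IsChain fun σ τ => ∀ x, σ x = none → τ x = none := by
  have h : ∀ u, g.Derives [Symbol.nonterminal g.initial] u → u.IsChain (Compatible g) := by
    intro u hu
    induction hu with
    | refl => simp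
    | tail _ h ih => exact isChain_of_produces hg hε h ih
  have hw := h _ hw
  rw [List.isChain_map] at hw
  refine hw.imp fun σ τ h x hx => ?_
  exact h (show x ∈ rightRank g [Symbol.terminal σ] from ⟨σ, [], .refl, hx⟩) τ [] .refl

end Ranks

/-- Everything after the first `none` is `none`, so the list is determined by its letters and its
length. -/
lemma eq_map_some_append_replicate {A : Type} (l : List (Option A))
    (h : l.IsChain fun a b => a = none → b = none) :
    l = l.reduceOption.map some ++ List.replicate (l.length - l.reduceOption.length) none := by
  induction l with
  | nil => rfl
  | cons a l ih =>
    replace ih := ih h.tail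
    cases a with
    | some a =>
      rw [List.reduceOption_cons_of_some]
      simpa using ih
    | none =>
      have hl : ∀ b ∈ l, b = none := by
        clear ih
        induction l with
        | nil => simp
        | cons b l ihl =>
          rw [List.isChain_cons_cons] at h
          have hb := h.1 rfl
          subst hb
          simpa using ihl h.2
      have : l.reduceOption = [] := by
        rw [List.eq_nil_iff_forall_not_mem]
        intro b hb
        have := hl _ (List.reduceOption_mem_iff.1 hb)
        simp at this
      rw [List.reduceOption_cons_of_none, this]
      simpa [List.eq_replicate_iff] using hl

/-! ### Word assignments -/

section WordAssignment

variable {k : ℕ} {A : Type}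

/-- Each track is the assigned word followed by padding, which the deletion of `#` removes. -/
lemma reduceOption_map_wordAssignment (u : Fin k → List (Option A)) (j : Fin k) :
    ((wordAssignment u).map fun σ => σ j).reduceOption = (u j).reduceOption := by
  have h : (u j).length ≤ Finset.univ.sup fun j => (u j).length :=
    Finset.le_sup (f := fun j => (u j).length) (Finset.mem_univ j)
  have h' : (wordAssignment u).map (fun σ => σ j) =
      u j ++ List.replicate ((Finset.univ.sup fun j => (u j).length) - (u j).length) none := by
    apply List.ext_getElem
    · simp [wordAssignment]; omega
    · intro i h₁ h₂
      simp only [wordAssignment, List.map_map, List.getElem_map, List.getElem_range,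
        Function.comp_apply]
      by_cases hi : i < (u j).length
      · simp [hi]
      · rw [List.getElem_append_right (by omega)]
        simp [List.getD, hi]
  rw [h', List.reduceOption_append, List.reduceOption_replicate_none, List.append_nil]

lemma wordAssignment_const (hk : 0 < k) (l : List (Option A)) :
    wordAssignment (fun _ : Fin k => l) = l.map fun a _ => a := by
  have h : (Finset.univ.sup fun _ : Fin k => l.length) = l.length :=
    Finset.sup_const ⟨⟨0, hk⟩, Finset.mem_univ _⟩ _
  apply List.ext_getElem
  · simp [wordAssignment, h]
  · intro i h₁ h₂
    rw [List.length_map] at h₂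
    funext j
    have h₃ : (wordAssignment fun _ : Fin k => l)[i] j = l.getD i none :=
      (congrFun (List.getElem_map _) j).trans (by rw [List.getElem_range])
    rw [h₃, List.getElem_map]
    simp [h₂]

/-- If all words of an assignment agree up to `#`, and only `#` follows `#`, then all letters are
homogeneous. -/
lemma homogeneous_of_isChain (u : Fin k → List (Option A)) {w : List A}
    (hu : ∀ j, (u j).reduceOption = w)
    (h : (wordAssignment u).IsChain fun σ τ => ∀ x, σ x = none → τ x = none) :
    ∀ σ ∈ wordAssignment u, ∀ i j, σ i = σ j := by
  -- The right-hand side does not depend on `j`: all tracks share their length and their word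
  -- without `#`.
  have key : ∀ j, (wordAssignment u).map (fun σ => σ j) =
      w.map some ++ List.replicate ((wordAssignment u).length - w.length) none := by
    intro j
    have h' := eq_map_some_append_replicate ((wordAssignment u).map fun σ => σ j)
      ((List.isChain_map _).2 (h.imp fun σ τ h => h j))
    rw [reduceOption_map_wordAssignment, hu, List.length_map] at h'
    exact h'
  intro σ hσ i j
  exact List.map_inj_left.1 ((key i).trans (key j).symm) σ hσ

end WordAssignment

/-! ### Nonemptiness of hypergrammars -/

namespace CFHG

variable {G : CFHG}

/-- Every universal quantifier is instantiated with the same word `w`. The second alternative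
records the inherited values of variables that the condition does not bind. -/
lemma Accepts.exists_assignment {L : Language (Fin G.s)} {w : List (Fin G.s)} (hw : w ∈ L)
    (α : List (Quantifier × Fin G.k)) (hα : ∀ p ∈ α, p.1 = Quantifier.all)
    (u : Fin G.k → List (Option (Fin G.s))) (h : G.Accepts L α u) :
    ∃ u', wordAssignment u' ∈ G.underlying.language ∧
      ∀ j, (u' j).reduceOption = w ∨ (j ∉ α.map Prod.snd ∧ u' j = u j) := by
  induction α generalizing u with
  | nil => exact ⟨u, h, fun j => .inr ⟨by simp, rfl⟩⟩
  | cons p α ih =>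
    obtain ⟨q, x⟩ := p
    obtain rfl : q = Quantifier.all := hα (q, x) (by simp)
    obtain ⟨w', hw', h⟩ := h w hw
    obtain ⟨u', hu', h⟩ := ih (fun p hp => hα p (by simp [hp])) _ h
    refine ⟨u', hu', fun j => ?_⟩
    rcases h j with h | ⟨h, h'⟩
    · exact .inl h
    · by_cases hj : j = x
      · subst hj
        rw [Function.update_self] at h'
        exact .inl (h' ▸ hw')
      · rw [Function.update_of_ne hj] at h'
        exact .inr ⟨by simpa [hj] using h, h'⟩

/-- An existential quantifier in front selects its word before the universal ones are instantiated,
so they can all be instantiated with that word. -/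
lemma exists_assignment (hG : G.IsForall ∨ G.IsExistsForall) {L : Language (Fin G.s)}
    (hL : L ∈ G.hyperlanguage) :
    ∃ w u, wordAssignment u ∈ G.underlying.language ∧ ∀ j, (u j).reduceOption = w := by
  obtain ⟨⟨w₀, hw₀⟩, hL⟩ := hL
  have hmem : ∀ j, j ∈ G.condition.map Prod.snd := by
    intro j
    simp [condition, Function.comp_def]
  rcases hG with ⟨-, hq⟩ | ⟨hk, hq⟩
  · obtain ⟨u, hu, h⟩ := Accepts.exists_assignment hw₀ G.condition (by simp [condition, hq]) _ hL
    exact ⟨w₀, u, hu, fun j => (h j).resolve_right fun h => h.1 (hmem j)⟩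
  · obtain ⟨x, α, hα⟩ : ∃ x α, List.finRange G.k = x :: α :=
      List.exists_cons_of_ne_nil (by simpa using hk.ne')
    have hx : (x : ℕ) = 0 := by
      have h := congrArg (fun l => (l.map Fin.val)[0]?) hα
      simpa [hk] using h.symm
    have hα' : ∀ j ∈ α, (j : ℕ) ≠ 0 := by
      intro j hj h
      have hnd := List.nodup_finRange G.k
      rw [hα, List.nodup_cons] at hnd
      exact hnd.1 ((Fin.ext (hx.trans h.symm) : x = j) ▸ hj)
    rw [condition, hα, List.map_cons, hq, if_pos hx] at hL
    obtain ⟨w, hw, w', hw', hL⟩ := hL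
    obtain ⟨u, hu, h⟩ := Accepts.exists_assignment hw _
      (fun p hp => by
        obtain ⟨j, hj, rfl⟩ := List.mem_map.1 hp
        exact (hq j).trans (if_neg (hα' j hj))) _ hL
    refine ⟨w, u, hu, fun j => (h j).elim id fun h => ?_⟩
    have hj : j ∈ x :: α := hα ▸ List.mem_finRange j
    have hj' : j = x := by
      rcases List.mem_cons.1 hj with hj | hj
      · exact hj
      · exact absurd (by simpa [Function.comp_def] using hj) h.1
    rw [h.2, hj', Function.update_self, hw']

/-- Over a singleton both quantifiers offer the same single word, and it can be padded to `l` each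
time. -/
lemma accepts_singleton (l : List (Option (Fin G.s)))
    (h : (wordAssignment fun _ => l) ∈ G.underlying.language)
    (α : List (Quantifier × Fin G.k)) (u : Fin G.k → List (Option (Fin G.s)))
    (hu : ∀ j, j ∈ α.map Prod.snd ∨ u j = l) : G.Accepts {l.reduceOption} α u := by
  induction α generalizing u with
  | nil =>
    obtain rfl : u = fun _ => l := funext fun j => by simpa using hu j
    exact h
  | cons p α ih =>
    obtain ⟨q, x⟩ := p
    have h' : G.Accepts {l.reduceOption} α (Function.update u x l) := by
      refine ih _ fun j => ?_
      by_cases hj : j = x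
      · subst hj; simp
      · simpa [hj] using hu j
    cases q with
    | all => exact fun w hw => ⟨l, (show w = l.reduceOption from hw).symm, h'⟩
    | ex => exact ⟨_, rfl, l, rfl, h'⟩

/-! ### Derivations in the homogeneous grammar. -/

lemma mem_rules_homogeneous {r : ContextFreeRule (Fin G.k → Option (Fin G.s)) (Fin G.n)} :
    r ∈ G.homogeneous.rules ↔
      r ∈ G.rules ∧ ∀ σ, Symbol.terminal σ ∈ r.output → ∃ a, σ = fun _ => a :=
  Finset.mem_filter.trans (and_congr_left fun _ => List.mem_toFinset)

lemma mem_rules_underlying {r : ContextFreeRule (Fin G.k → Option (Fin G.s)) (Fin G.n)} :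
    r ∈ G.underlying.rules ↔ r ∈ G.rules :=
  List.mem_toFinset

/-- Terminals are never rewritten, so each letter of a rule used in the derivation survives in `w`
and is homogeneous. -/
lemma derives_homogeneous {u : List (Symbol (Fin G.k → Option (Fin G.s)) (Fin G.n))}
    {w : List (Fin G.k → Option (Fin G.s))} (hw : ∀ σ ∈ w, ∃ a, σ = fun _ => a)
    (h : G.underlying.Derives u (w.map Symbol.terminal)) :
    G.homogeneous.Derives u (w.map Symbol.terminal) := by
  induction h using Relation.ReflTransGen.head_induction_on with
  | refl => exact .refl _
  | head h _ ih =>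
    obtain ⟨r, hr, h⟩ := h
    refine .head ⟨r, mem_rules_homogeneous.2 ⟨mem_rules_underlying.1 hr, fun σ hσ => hw σ ?_⟩, h⟩ ih
    obtain ⟨p, q, rfl, rfl⟩ := h.exists_parts
    have := ContextFreeGrammar.Derives.terminal_mem ih (a := σ)
      (List.mem_append_left _ (List.mem_append_right _ hσ))
    simpa using this

lemma derives_of_derives_homogeneous
    {u v : List (Symbol (Fin G.k → Option (Fin G.s)) (Fin G.n))}
    (h : G.homogeneous.Derives u v) :
    G.underlying.Derives u v ∧ ((∀ σ, Symbol.terminal σ ∈ u → ∃ a, σ = fun _ => a) →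
      ∀ σ, Symbol.terminal σ ∈ v → ∃ a, σ = fun _ => a) := by
  induction h with
  | refl => exact ⟨.refl _, id⟩
  | tail _ h ih =>
    obtain ⟨r, hr, h⟩ := h
    have hr := mem_rules_homogeneous.1 hr
    refine ⟨ih.1.tail ⟨r, mem_rules_underlying.2 hr.1, h⟩, fun hu σ hσ => ?_⟩
    have hv := ih.2 hu σ
    obtain ⟨p, q, rfl, rfl⟩ := h.exists_parts
    rcases List.mem_append.1 hσ with hσ | hσ
    · rcases List.mem_append.1 hσ with hσ | hσ
      · exact hv (List.mem_append_left _ (List.mem_append_left _ hσ))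
      · exact hr.2 σ hσ
    · exact hv (List.mem_append_right _ hσ)

theorem exists_mem_language_homogeneous (hs : G.IsSync) (hG : G.IsForall ∨ G.IsExistsForall)
    (h : G.hyperlanguage.Nonempty) : ∃ w, w ∈ G.homogeneous.language := by
  -- The initial variable may occur inside right-hand sides, so an empty rule can break the chain
  -- argument. In that case the empty word settles the claim.
  by_cases hε : ∃ r ∈ G.underlying.rules, r.output = []
  · obtain ⟨r, hr, hr'⟩ := hε
    have hi : r.input = G.start := hs.1 r hr hr'
    refine ⟨[], Relation.ReflTransGen.single
      ⟨r, mem_rules_homogeneous.2 ⟨mem_rules_underlying.1 hr,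
        fun σ hσ => absurd (hr' ▸ hσ) List.not_mem_nil⟩, ?_⟩⟩
    have h := ContextFreeRule.Rewrites.input_output (r := r)
    rw [hi, hr'] at h
    exact h
  · push Not at hε
    obtain ⟨L, hL⟩ := h
    obtain ⟨w, u, hu, hw⟩ := exists_assignment hG hL
    have hk : 0 < G.k := hG.elim And.left And.left
    have hhom := homogeneous_of_isChain u hw (isChain_of_mem_language hs.2 hε hu)
    exact ⟨wordAssignment u, derives_homogeneous
      (fun σ hσ => ⟨σ ⟨0, hk⟩, funext fun j => hhom σ hσ _ _⟩) hu⟩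

theorem exists_singleton_mem_hyperlanguage (hk : 0 < G.k)
    (h : ∃ w, w ∈ G.homogeneous.language) :
    ∃ w, ({w} : Language (Fin G.s)) ∈ G.hyperlanguage := by
  obtain ⟨w, hw⟩ := h
  obtain ⟨hw, hhom⟩ := derives_of_derives_homogeneous hw
  have hw' : wordAssignment (fun _ : Fin G.k => w.map fun σ => σ ⟨0, hk⟩) = w := by
    rw [wordAssignment_const hk, List.map_map]
    conv_rhs => rw [← List.map_id w]
    refine List.map_congr_left fun σ hσ => ?_
    have hinit : ∀ σ : Fin G.k → Option (Fin G.s),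
        Symbol.terminal σ ∉ [Symbol.nonterminal G.start] := by simp
    obtain ⟨a, rfl⟩ := hhom (fun σ hσ => absurd hσ (hinit σ)) σ (List.mem_map_of_mem hσ)
    rfl
  refine ⟨(w.map fun σ => σ ⟨0, hk⟩).reduceOption, ⟨_, rfl⟩, accepts_singleton _ ?_ _ _ ?_⟩
  · rw [hw']
    exact hw
  · intro j
    left
    simp [condition, Function.comp_def]

theorem nonempty_iff_homogeneous (hs : G.IsSync) (hG : G.IsForall ∨ G.IsExistsForall) :
    G.hyperlanguage.Nonempty ↔ ∃ w, w ∈ G.homogeneous.language :=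
  ⟨exists_mem_language_homogeneous hs hG, fun h =>
    let ⟨_, hw⟩ := exists_singleton_mem_hyperlanguage (hG.elim And.left And.left) h
    ⟨_, hw⟩⟩

end CFHG

/-! ### The nonemptiness problem in polynomial time -/

namespace CFHG

open StackProgram

/-- The word that names a number. -/
def nameWord (m : ℕ) : Word := (encodeNat m).map some

lemma nameWord_injective : Function.Injective nameWord := by
  intro a b h
  have h := List.map_injective_iff.2 (Option.some_injective _) h
  rw [← decode_encodeNat a, h, decode_encodeNat]

/-- Words that begin with a blank are thus free to stand for `#`, for the goal and for the
artificial premise. -/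
lemma head_nameWord (m : ℕ) : (nameWord m).head? ≠ some none := by
  rw [nameWord]
  cases encodeNat m <;> simp

lemma encodeName_eq (m : ℕ) : encodeName m = encodeWord (nameWord m) := by
  simp [encodeName, encodeWord, nameWord, chars, Function.comp_def, charSymbol]

/-- The word that names an element of `Σ ∪ {#}`. -/
def entryWord {s : ℕ} : Option (Fin s) → Word
  | none => [none]
  | some a => nameWord a

lemma entryWord_injective {s : ℕ} : Function.Injective (entryWord (s := s)) := by
  rintro (_ | a) (_ | b) h
  · rfl
  · exact absurd (congrArg List.head? h.symm) (head_nameWord b)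
  · exact absurd (congrArg List.head? h) (head_nameWord a)
  · exact congrArg some (Fin.ext (nameWord_injective h))

lemma encodeEntry_eq {s : ℕ} (a : Option (Fin s)) : encodeEntry a = encodeWord (entryWord a) := by
  cases a with
  | none => rfl
  | some a => exact encodeName_eq a

section Rules

variable {s k n : ℕ}

/-- The symbol of a rule as it is read by the program. -/
def symbolToken : Symbol (Fin k → Option (Fin s)) (Fin n) → Token
  | .terminal σ => .letter (((List.finRange k).map fun j => entryWord (σ j)).headD [])
      ((List.finRange k).map fun j => entryWord (σ j)).tail
  | .nonterminal v => .name (nameWord v)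

lemma encodeSymbol_eq (hk : 0 < k) (a : Symbol (Fin k → Option (Fin s)) (Fin n)) :
    encodeSymbol a = encodeToken (symbolToken a) := by
  cases a with
  | nonterminal v => exact encodeName_eq v
  | terminal σ =>
    obtain ⟨x, l, hl⟩ : ∃ x l, List.finRange k = x :: l :=
      List.exists_cons_of_ne_nil (by simpa using hk.ne')
    simp [encodeSymbol, symbolToken, encodeToken, hl, encodeEntry_eq, encodeWords,
      List.flatMap_map]

lemma premises_terminal_eq_nil (σ : Fin k → Option (Fin s)) (hk : 0 < k) :
    (∃ a, σ = fun _ => a) ↔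
      (symbolToken (n := n) (Symbol.terminal σ)).premises = [] := by
  obtain ⟨x, l, hl⟩ : ∃ x l, List.finRange k = x :: l :=
    List.exists_cons_of_ne_nil (by simpa using hk.ne')
  have h : (symbolToken (n := n) (Symbol.terminal σ)).premises = [] ↔ ∀ j ∈ l, σ j = σ x := by
    simp [symbolToken, Token.premises, hl, entryWord_injective.eq_iff]
  rw [h]
  constructor
  · rintro ⟨a, rfl⟩
    simp
  · intro h
    refine ⟨σ x, funext fun j => ?_⟩
    rcases List.mem_cons.1 (hl ▸ List.mem_finRange j) with rfl | hj
    · rfl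
    · exact h j hj

lemma mem_premises_terminal {σ : Fin k → Option (Fin s)} {w : Word}
    (hw : w ∈ (symbolToken (n := n) (Symbol.terminal σ)).premises) : w = [none] := by
  rw [symbolToken, Token.premises] at hw
  split_ifs at hw
  · simp at hw
  · exact List.mem_singleton.1 hw

/-- A rule as it is read by the program. -/
def tokenRule (r : ContextFreeRule (Fin k → Option (Fin s)) (Fin n)) : TokenRule :=
  (nameWord r.input, r.output.map symbolToken)

lemma encodeRule_eq (hk : 0 < k) (r : ContextFreeRule (Fin k → Option (Fin s)) (Fin n)) :
    encodeRule r = encodeTokenRule (tokenRule r) := by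
  have h : encodeSymbol (s := s) (n := n) = fun a => encodeToken (symbolToken a) :=
    funext (encodeSymbol_eq hk)
  simp [encodeRule, encodeTokenRule, tokenRule, encodeName_eq, encodeTokens, List.flatMap_map, h]

end Rules

/-! ### The clauses of a hypergrammar and their correctness. -/

variable (G : CFHG)

/-- The quantifiers of a hypergrammar as bits. -/
def quantifierBits : List Bool :=
  (List.finRange G.k).map fun j =>
    match G.quant j with
    | .all => false
    | .ex => true

lemma encode_eq (hk : 0 < G.k) :
    G.encode = encodeInput (nameWord G.s) (nameWord G.k) (nameWord G.n) (nameWord G.start)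
      G.quantifierBits (G.rules.map tokenRule) := by
  have h₁ : (List.finRange G.k).map (fun j => encodeQuantifier (G.quant j)) =
      chars (G.quantifierBits.map some) := by
    simp only [quantifierBits, chars, List.map_map]
    refine List.map_congr_left fun j _ => ?_
    simp only [Function.comp_apply]
    cases G.quant j <;> rfl
  have h₂ : G.rules.flatMap encodeRule = encodeTokenRules (G.rules.map tokenRule) := by
    have h : encodeRule (s := G.s) (n := G.n) = fun r => encodeTokenRule (tokenRule r) :=
      funext (encodeRule_eq hk)
    simp [encodeTokenRules, List.flatMap_map, h]
  rw [encode, h₁, h₂, encodeInput]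
  simp only [encodeName_eq, List.append_assoc]

variable {G}

/-- The clauses that correspond to a hypergrammar. -/
def clauses (G : CFHG) : List Clause :=
  inputClauses (nameWord G.start) (G.rules.map tokenRule)

lemma derivable_of_productive (hk : 0 < G.k) {v : G.homogeneous.NT}
    (h : G.homogeneous.Productive v) :
    Derivable G.clauses [] (nameWord (Fin.val (n := G.n) v)) := by
  induction h with
  | @rule r hr _ ih =>
    have hr := mem_rules_homogeneous.1 hr
    refine Derivable.clause (c := toClause (tokenRule r)) (List.mem_cons_of_mem _
      (List.mem_map_of_mem (List.mem_map_of_mem hr.1))) fun w hw => ?_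
    obtain ⟨t, ht, hw⟩ := List.mem_flatMap.1 hw
    obtain ⟨a, ha, rfl⟩ := List.mem_map.1 ht
    cases a with
    | terminal σ =>
      rw [(premises_terminal_eq_nil σ hk).1 (hr.2 σ ha)] at hw
      simp at hw
    | nonterminal v =>
      rw [List.mem_singleton.1 hw]
      exact ih v ha

/-- The goal and the artificial premise of inhomogeneous letters are the same word `[none]`. This is
harmless: its only clause needs the initial variable, so once `[none]` is derived the first
alternative holds. -/
lemma productive_of_derivable (hk : 0 < G.k) {w : Word} (h : Derivable G.clauses [] w) :
    G.homogeneous.Productive G.start ∨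
      ∃ v : Fin G.n, w = nameWord v ∧ G.homogeneous.Productive v := by
  induction h with
  | fact h => simp at h
  | @clause c hc _ ih =>
    by_cases hs : G.homogeneous.Productive G.start
    · exact .inl hs
    -- If the initial variable is not productive, every premise names a variable. This excludes
    -- `[none]` and hence all inhomogeneous letters.
    have ih : ∀ w ∈ c.2, ∃ v : Fin G.n, w = nameWord v ∧ G.homogeneous.Productive v :=
      fun w hw => (ih w hw).resolve_left hs
    rcases List.mem_cons.1 hc with rfl | hc
    · obtain ⟨v, hv, h⟩ := ih _ (List.mem_singleton_self _)
      obtain rfl : G.start = v := Fin.ext (nameWord_injective hv)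
      exact .inl h
    · obtain ⟨_, hr', rfl⟩ := List.mem_map.1 hc
      obtain ⟨r, hr, rfl⟩ := List.mem_map.1 hr'
      have hmem : ∀ a ∈ r.output, ∀ w ∈ (symbolToken a).premises,
          w ∈ (toClause (tokenRule r)).2 := fun a ha w hw =>
        List.mem_flatMap.2 ⟨_, List.mem_map_of_mem ha, hw⟩
      refine .inr ⟨r.input, rfl, .rule (mem_rules_homogeneous.2 ⟨hr, fun σ hσ => ?_⟩) ?_⟩
      · rw [premises_terminal_eq_nil (n := G.n) σ hk, List.eq_nil_iff_forall_not_mem]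
        intro w hw
        obtain ⟨v, hv, -⟩ := ih w (hmem _ hσ w hw)
        rw [mem_premises_terminal hw] at hv
        exact head_nameWord v (congrArg List.head? hv.symm)
      · intro v hv
        obtain ⟨v', hv', h⟩ := ih (nameWord (Fin.val (n := G.n) v))
          (hmem _ hv _ (List.mem_singleton_self _))
        obtain rfl : v = v' := Fin.ext (nameWord_injective hv')
        exact h

lemma saturate_clauses_iff (hk : 0 < G.k) :
    saturate false (G.clauses.foldl emit ([], [])) = true ↔ ∃ w, w ∈ G.homogeneous.language := by
  rw [saturate_foldl_emit, ContextFreeGrammar.exists_mem_language_iff_productive]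
  constructor
  · rintro ⟨w, hw, h⟩
    rcases productive_of_derivable hk hw with h' | ⟨v, rfl, -⟩
    · exact h'
    · exact absurd h (head_nameWord v)
  · intro h
    refine ⟨[none], Derivable.clause (c := ([none], [nameWord G.start])) (List.mem_cons_self ..)
      fun w hw => ?_, rfl⟩
    rw [List.mem_singleton.1 hw]
    exact derivable_of_productive hk h

/-- Nonemptiness can be decided in polynomial time for every class of `∀*`- and
`∃∀*`-syncCFHG. -/
theorem decidableInPolyTime_nonempty (C : CFHG → Prop)
    (hC : ∀ G, C G → G.IsSync ∧ (G.IsForall ∨ G.IsExistsForall)) :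
    DecidableInPolyTime (fun G : {G : CFHG // C G} => G.1.encode)
      (fun G => G.1.hyperlanguage.Nonempty) := by
  refine decidableInPolyTime_of_does mainProgram Stack.inp ⟨true, false, false⟩ Register.goal
    (28 * (Polynomial.X + 1) ^ 2) fun G =>
    ⟨⟨true, false, saturate false (G.1.clauses.foldl emit ([], []))⟩, ?_, ?_⟩
  · have hk : 0 < G.1.k := (hC G.1 G.2).2.elim And.left And.left
    rw [G.1.encode_eq hk]
    have hcells : ∀ I, Function.update (fun _ => []) Stack.inp I = cells I [] [] [] [] := by
      intro I
      funext j
      cases j <;> rfl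
    have hnil : (fun _ => []) = cells [] [] [] [] [] := by
      funext j
      cases j <;> rfl
    rw [hcells, hnil]
    refine Does.of_eq (does_mainProgram _ _ _ _ _ _) rfl ?_
    simp
  · obtain ⟨hs, hG⟩ := hC G.1 G.2
    exact (saturate_clauses_iff (hG.elim And.left And.left)).trans
      (nonempty_iff_homogeneous hs hG).symm

end CFHG

theorem mainTheorem5 :
    DecidableInPolyTime (fun G : {G : CFHG // G.IsSync ∧ G.IsForall} => G.1.encode)
        (fun G => G.1.hyperlanguage.Nonempty) ∧
      DecidableInPolyTime (fun G : {G : CFHG // G.IsSync ∧ G.IsExistsForall} => G.1.encode)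
        (fun G => G.1.hyperlanguage.Nonempty) ∧
      ∀ G : CFHG, G.IsSync → G.IsForall ∨ G.IsExistsForall →
        (G.hyperlanguage.Nonempty ↔ ∃ w, ({w} : Language (Fin G.s)) ∈ G.hyperlanguage) ∧
        (G.hyperlanguage.Nonempty ↔ ∃ w, w ∈ G.homogeneous.language) := by
  refine ⟨CFHG.decidableInPolyTime_nonempty _ fun G h => ⟨h.1, .inl h.2⟩,
    CFHG.decidableInPolyTime_nonempty _ fun G h => ⟨h.1, .inr h.2⟩, fun G hs hG => ⟨?_, ?_⟩⟩
  · refine ⟨fun h => CFHG.exists_singleton_mem_hyperlanguage (hG.elim And.left And.left)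
      (CFHG.exists_mem_language_homogeneous hs hG h), fun ⟨_, hw⟩ => ⟨_, hw⟩⟩
  · exact CFHG.nonempty_iff_homogeneous hs hG
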